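/- **Conventions.** A partition is a non-increasing sequence $\lambda=(\lambda_1,\lambda_2,\dots)$ of non-negative integers with finitely many nonzero entries (its parts); its length is the number of nonzero parts, its Ferrers diagram is $\{(i,j)\in\mathbb Z^2 : j\ge 1,\ 1\le i\le\lambda_j\}$, and $\lambda'$ is the conjugate partition. For finite sequences put $\Delta(\mathcal X)=\prod_{i<j}(\mathcal X_i-\mathcal X_j)$ and $\Delta(\mathcal X;\mathcal Y)=\prod_{x\in\mathcal X,\,y\in\mathcal Y}(x-y)$. For $\mathcal X=(x_1,\dots,x_n)$, the Schur function is $\mathfrak s_\lambda(\mathcal X)=\det\big(x_i^{\lambda_j+n-j}\big)_{1\le i,j\le n}/\Delta(\mathcal X)$ if $\lambda$ has length at most $n$ (a polynomial in $x_1,\dots,x_n$, hence also defined when there are repetitions), and $0$ otherwise. The Littlewood-Richardson coefficients $c^\lambda_{\mu\nu}$ are the integers with $\mathfrak s_\mu\mathfrak s_\nu=\sum_\lambda c^\lambda_{\mu\nu}\mathfrak s_\lambda$ in every number of variables, and the Littlewood-Schur function is $$LS_\lambda(\mathcal X;\mathcal Y)=\sum_{\mu,\nu}c^\lambda_{\mu\nu}\,\mathfrak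 s_\mu(\mathcal X)\,\mathfrak s_{\nu'}(\mathcal Y).$$ The $(m,n)$-index of $\lambda$ is the largest (possibly negative) integer $k\le\min\{m,n\}$ such that $(m+1-k,\,n+1-k)$ does not lie in the Ferrers diagram of $\lambda$. Put $\rho_a=(a-1,\dots,1,0)$. Let $\mu,\nu$ be partitions of length at most $a$ and $b$, respectively. A partition $\kappa$ of length at most $a+b$ is the $(a,b)$-overlap of $\mu$ and $\nu$, written $\kappa=\mu\star_{a,b}\nu$, if the sequence $\kappa+\rho_{a+b}$ is a rearrangement of the sequence $(\mu_1+a-1,\dots,\mu_a,\nu_1+b-1,\dots,\nu_b)$. In that case the entries of the latter sequence are pairwise distinct, and $\varepsilon_{a,b}(\mu,\nu)$ denotes the sign of the permutation that sorts it into decreasing order. **Theorem (first overlap identity).** Let $F$ be a field, let $\mathcal X=(x_1,\dots,x_n)$ be a sequence of $n\ge 0$ pairwise distinct elements of $F$ and $\mathcal Y=(y_1,\dots,y_m)$ a sequence of $m\ge 0$ elements of $F$. Let $\lambda$ be a partition with $(m,n)$-index $k$, let $0\le l\le\min\{n-k,n\}$ be an integer, and let $\mu,\nu$ be partitions such that $$\lambda_{[n-k]}:=(\lambda_1,\dots,\lambda_{n-k})=\mu\star_{l,\,n-k-l}\nu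 .$$ Then the sequences $$\mu+\langle k^l\rangle:=(\mu_1+k,\dots,\mu_l+k),\qquad \nu\cup\lambda_{(n+1-k,n+2-k,\dots)}:=(\nu_1,\dots,\nu_{n-k-l},\lambda_{n+1-k},\lambda_{n+2-k},\dots)$$ are partitions, and $$LS_\lambda(-\mathcal X;\mathcal Y)=\sum_{\mathcal S,\mathcal T}\frac{\varepsilon_{l,n-k-l}(\mu,\nu)\;LS_{\mu+\langle k^l\rangle}(-\mathcal S;\mathcal Y)\;LS_{\nu\cup\lambda_{(n+1-k,n+2-k,\dots)}}(-\mathcal T;\mathcal Y)}{\Delta(\mathcal T;\mathcal S)},$$ where the sum runs over all pairs of complementary subsequences $\mathcal S,\mathcal T$ of $\mathcal X$ with $l$ and $n-l$ elements, respectively, and $-\mathcal X$, $-\mathcal S$, $-\mathcal T$ denote entrywise negation. -/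

import Mathlib

noncomputable section

namespace Overlap

/-! ### Sequences -/

/-- `Δ(x) = ∏_{i < j} (x_i - x_j)`. -/
def delta {R : Type*} [CommRing R] {n : ℕ} (x : Fin n → R) : R :=
  ∏ i, ∏ j ∈ Finset.Ioi i, (x i - x j)

/-- `Δ(x; y) = ∏_{i, j} (x_i - y_j)`. -/
def delta₂ {R : Type*} [CommRing R] {n m : ℕ} (x : Fin n → R) (y : Fin m → R) : R :=
  ∏ i, ∏ j, (x i - y j)

/-- The subsequence of `x` with index set `A`, in increasing order of the indices. -/
def subseq {R : Type*} {n : ℕ} (x : Fin n → R) (A : Finset (Fin n)) : Fin A.card → R :=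
  fun i => x (A.orderEmbOfFin rfl i)

/-! ### Partitions

A partition is a `YoungDiagram`; its `(i+1)`-st part is `rowLen i` and its length is `colLen 0`. -/

/-- The sequence of parts of a partition (followed by zeros), indexed from `0`. -/
def parts (μ : YoungDiagram) : ℕ → ℤ := fun i => (μ.rowLen i : ℤ)

/-- A sequence of integers is (the sequence of parts of) a partition if it is non-increasing and
eventually zero. -/
def IsPartitionSeq (f : ℕ → ℤ) : Prop :=
  Antitone f ∧ ∃ N, ∀ i, N ≤ i → f i = 0

theorem IsPartitionSeq.finite {f : ℕ → ℤ} (h : IsPartitionSeq f) :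
    {c : ℕ × ℕ | (c.2 : ℤ) < f c.1}.Finite := by
  obtain ⟨ha, N, hN⟩ := h
  refine ((Set.finite_lt_nat N).prod (Set.finite_lt_nat (f 0).toNat)).subset ?_
  rintro ⟨i, j⟩ hij
  simp only [Set.mem_ofPred_eq] at hij
  have h0 := ha (Nat.zero_le i)
  refine ⟨?_, ?_⟩
  · simp only [Set.mem_ofPred_eq]
    by_contra hc
    have := hN i (by omega)
    omega
  · simp only [Set.mem_ofPred_eq]
    omega

/-- The partition with a given sequence of parts. -/
def ofSeq (f : ℕ → ℤ) (h : IsPartitionSeq f) : YoungDiagram where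
  cells := h.finite.toFinset
  isLowerSet := by
    rintro ⟨i, j⟩ ⟨i', j'⟩ ⟨hi, hj⟩ hc
    simp only [Set.Finite.coe_toFinset, Set.mem_ofPred_eq] at hc ⊢
    have := h.1 hi
    simp only at hj this
    omega

theorem parts_ofSeq (f : ℕ → ℤ) (h : IsPartitionSeq f) : parts (ofSeq f h) = f := by
  funext i
  have h0 : 0 ≤ f i := by
    obtain ⟨ha, N, hN⟩ := h
    have := ha (le_max_left i N)
    rw [hN _ (le_max_right i N)] at this
    exact this
  have key : ∀ j : ℕ, j < (ofSeq f h).rowLen i ↔ (j : ℤ) < f i := by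
    intro j
    rw [← YoungDiagram.mem_iff_lt_rowLen, ← YoungDiagram.mem_cells]
    simp [ofSeq]
  have h1 := key (f i).toNat
  have h2 := key ((ofSeq f h).rowLen i)
  unfold parts
  omega

/-- `λ_{[N]}`: the partition consisting of the first `N` parts of `λ`. -/
def firstParts (N : ℕ) (lam : YoungDiagram) : YoungDiagram where
  cells := lam.cells.filter (fun c => c.1 < N)
  isLowerSet := by
    rintro ⟨i, j⟩ ⟨i', j'⟩ ⟨hi, hj⟩ hc
    simp only [Finset.coe_filter, Set.mem_ofPred_eq, YoungDiagram.mem_cells] at hc ⊢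
    exact ⟨lam.up_left_mem hi hj hc.1, lt_of_le_of_lt hi hc.2⟩

/-- The sequence `(f_{N+1}, f_{N+2}, …)` (in 1-based indexing). -/
def tailSeq (N : ℕ) (f : ℕ → ℤ) : ℕ → ℤ := fun i => f (N + i)

/-- The sequence `⟨k^l⟩ = (k, …, k)` with `l` entries (followed by zeros); `k` may be negative. -/
def rectSeq (k : ℤ) (l : ℕ) : ℕ → ℤ := fun i => if i < l then k else 0

/-- The union of `(f_1, …, f_p)` and `g`: the sequence `g` is appended to `(f_1, …, f_p)`. -/
def appendSeq (p : ℕ) (f g : ℕ → ℤ) : ℕ → ℤ := fun i => if i < p then f i else g (i - p)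

/-- `k` is the `(m,n)`-index of `λ`: the largest integer `k ≤ min(m,n)` such that the point
`(m+1-k, n+1-k)` does not lie in the Ferrers diagram `{(i,j) | 1 ≤ i ≤ λ_j}` of `λ`.
(The cells of a `YoungDiagram` are 0-based, and their first coordinate is the row.) -/
def IsIndex (m n : ℕ) (lam : YoungDiagram) (k : ℤ) : Prop :=
  IsGreatest {k : ℤ | k ≤ min (m : ℤ) (n : ℤ) ∧ ((n - k).toNat, (m - k).toNat) ∉ lam} k

/-! ### Overlap -/

/-- The sequence `(μ + ρ_a) ∪ (ν + ρ_b)` of length `a + b`, where `ρ_a = (a-1, …, 1, 0)`. -/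
def overlapSeq (a b : ℕ) (μ ν : YoungDiagram) : Fin (a + b) → ℕ :=
  Fin.append (fun i : Fin a => μ.rowLen i + (i.rev : ℕ)) (fun j : Fin b => ν.rowLen j + (j.rev : ℕ))

/-- `κ` is the `(a,b)`-overlap of `μ` and `ν`: the lengths of `μ` and `ν` are at most `a` and `b`,
and `κ + ρ_{a+b}` is equal to `(μ + ρ_a) ∪ (ν + ρ_b)` up to reordering. -/
def IsOverlap (a b : ℕ) (μ ν κ : YoungDiagram) : Prop :=
  μ.colLen 0 ≤ a ∧ ν.colLen 0 ≤ b ∧ κ.colLen 0 ≤ a + b ∧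
    ∃ σ : Equiv.Perm (Fin (a + b)), ∀ i : Fin (a + b), κ.rowLen i + (i.rev : ℕ) = overlapSeq a b μ ν (σ i)

open Classical in
/-- The sign `ε_{a,b}(μ,ν)`: the sign of the permutation that sorts `(μ + ρ_a) ∪ (ν + ρ_b)` into
strictly decreasing order if there is one (it is then unique), and `1` otherwise. -/
def overlapSign (a b : ℕ) (μ ν : YoungDiagram) : ℤˣ :=
  if h : ∃ σ : Equiv.Perm (Fin (a + b)), StrictAnti (overlapSeq a b μ ν ∘ σ) then
    Equiv.Perm.sign h.choose
  else 1

/-! ### Schur functions -/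

/-- The alternant `det (x_i ^ (λ_j + n - j))` in the polynomial ring `ℤ[x_1, …, x_n]`. -/
def alternant (n : ℕ) (lam : YoungDiagram) : MvPolynomial (Fin n) ℤ :=
  (Matrix.of fun i j : Fin n =>
    (MvPolynomial.X i : MvPolynomial (Fin n) ℤ) ^ (lam.rowLen j + (j.rev : ℕ))).det

theorem prime_X_sub_X {n : ℕ} {i j : Fin n} (h : i ≠ j) :
    Prime (MvPolynomial.X i - MvPolynomial.X j : MvPolynomial (Fin n) ℤ) := by
  classical
  have hc : MvPolynomial.coeff (Finsupp.single i 1)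
      (MvPolynomial.X i - MvPolynomial.X j : MvPolynomial (Fin n) ℤ) = 1 := by
    have hs : Finsupp.single j 1 ≠ (Finsupp.single i 1 : Fin n →₀ ℕ) := fun hs =>
      h (Finsupp.single_left_injective one_ne_zero hs).symm
    rw [MvPolynomial.coeff_sub, MvPolynomial.coeff_X, MvPolynomial.coeff_X, if_pos rfl,
      if_neg hs, sub_zero]
  refine (MvPolynomial.irreducible_of_totalDegree_eq_one (le_antisymm ?_ ?_) ?_).prime
  · refine (MvPolynomial.totalDegree_sub _ _).trans ?_
    simp [MvPolynomial.totalDegree_X]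
  · have := MvPolynomial.le_totalDegree (p := (MvPolynomial.X i - MvPolynomial.X j :
      MvPolynomial (Fin n) ℤ)) (s := Finsupp.single i 1)
      (by rw [MvPolynomial.mem_support_iff, hc]; exact one_ne_zero)
    simpa using this
  · intro x hx
    have := hx (Finsupp.single i 1)
    rw [hc] at this
    exact isUnit_of_dvd_one this

theorem delta_dvd_alternant (n : ℕ) (lam : YoungDiagram) :
    delta (fun i : Fin n => (MvPolynomial.X i : MvPolynomial (Fin n) ℤ)) ∣ alternant n lam := by
  classical
  unfold delta
  rw [Finset.prod_sigma']
  refine Finset.prod_dvd_of_isRelPrime ?_ ?_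
  · rintro ⟨i, j⟩ hij ⟨a, b⟩ hab hne
    simp only [Finset.coe_sigma, Finset.coe_univ, Set.mem_sigma_iff, Set.mem_univ, true_and,
      Finset.mem_coe, Finset.mem_Ioi] at hij hab
    refine (prime_X_sub_X hij.ne).irreducible.isRelPrime_iff_not_dvd.mpr ?_
    rintro ⟨q, hq⟩
    let v : Fin n → ℤ := fun c => if c = i ∨ c = j then 0 else (c : ℤ) + 1
    have hq' := congrArg (MvPolynomial.eval v) hq
    have hvi : v i = 0 := by simp [v]
    have hvj : v j = 0 := by simp [v]
    simp only [map_sub, map_mul, MvPolynomial.eval_X, hvi, hvj, sub_zero, zero_mul] at hq'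
    have hne' : ¬ (i = a ∧ j = b) := by
      rintro ⟨rfl, rfl⟩
      exact hne rfl
    simp only [v] at hq'
    simp only [Fin.ext_iff, Fin.lt_def] at *
    split_ifs at hq' <;> omega
  · rintro ⟨i, j⟩ hij
    simp only [Finset.mem_sigma, Finset.mem_univ, true_and, Finset.mem_Ioi] at hij
    rw [← Ideal.mem_span_singleton, ← Ideal.Quotient.eq_zero_iff_mem, alternant, RingHom.map_det]
    refine Matrix.det_zero_of_row_eq hij.ne ?_
    funext c
    have : Ideal.Quotient.mk (Ideal.span {(MvPolynomial.X i - MvPolynomial.X j :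
        MvPolynomial (Fin n) ℤ)}) (MvPolynomial.X i) =
        Ideal.Quotient.mk _ (MvPolynomial.X j) := by
      rw [Ideal.Quotient.eq]
      exact Ideal.mem_span_singleton_self _
    simp [this]

/-- The Schur polynomial `s_λ(x_1, …, x_n)`: zero if the length of `λ` exceeds `n`, and otherwise
the quotient of the alternant by the Vandermonde product `Δ(x_1, …, x_n)`. -/
def schurPoly (n : ℕ) (lam : YoungDiagram) : MvPolynomial (Fin n) ℤ :=
  if n < lam.colLen 0 then 0 else (delta_dvd_alternant n lam).choose

/-- The value `s_λ(x)` of the Schur function at a sequence `x`, possibly with repetitions. -/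
def schur {R : Type*} [CommRing R] (lam : YoungDiagram) {n : ℕ} (x : Fin n → R) : R :=
  MvPolynomial.aeval x (schurPoly n lam)

/-! ### Littlewood-Schur functions -/

open Classical in
/-- The Littlewood-Richardson coefficients `c^λ_{μν}` as a function of `λ`: the finitely supported
family of integers with `s_μ s_ν = ∑_λ c^λ_{μν} s_λ` for every number of variables (such a family
exists and is unique). -/
def lrCoeff (μ ν : YoungDiagram) : YoungDiagram →₀ ℤ :=
  if h : ∃ c : YoungDiagram →₀ ℤ, ∀ n : ℕ,
      schurPoly n μ * schurPoly n ν = c.sum fun lam a => a • schurPoly n lam then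
    h.choose
  else 0

/-- The Littlewood-Schur function
`LS_λ(x; y) = ∑_{μ,ν} c^λ_{μν} s_μ(x) s_{ν'}(y)`; only finitely many terms are nonzero. -/
def LS {R : Type*} [CommRing R] (lam : YoungDiagram) {n m : ℕ} (x : Fin n → R) (y : Fin m → R) :
    R :=
  ∑ᶠ p : YoungDiagram × YoungDiagram,
    (lrCoeff p.1 p.2 lam : R) * schur p.1 x * schur p.2.transpose y

end Overlap

end

open Overlap

noncomputable section

namespace Overlap

/-! ### Coefficients of alternants -/

/-! Write `z` for the negated variables, `H = ∏ (1 - z_i T)⁻¹` and `E = ∏ (1 + y_j T)`. The proof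
has two halves.

First, a Littlewood-Schur function is a Jacobi-Trudi determinant (`LS_eq_jt`): for every `L` not
less than the length of `λ`, it is the determinant with entries `[T^(λ_i + L - i)] T^(L - j) H E`. A
product `∏ P(t_a)` expands in Schur functions of `t` with Jacobi-Trudi determinants of `P` as
coefficients (`cauchy_identity`). Multiplying the expansions for `H` and `E` and extracting the
coefficient of `t^(λ+ρ)` from `Δ(t)` times the product yields the defining sum, because that
extraction is also what computes Littlewood-Richardson coefficients. The Jacobi-Trudi formula and
its dual (`schur_eq_jt_hgen`, `schur_transpose_eq_jt_egen`) identify the factors.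

Second, partial fractions show that far enough out the coefficients of `H E` are power sums `∑_p w_p
z_p^e` with explicit weights (`coeff_X_pow_mul_hgen_mul_egen`). The index condition gives `λ_i ≥ m -
k` for `i ≤ n - k`, so the first `n - k` rows of the determinant are combinations of the evaluation
rows `(z_p^j)_j`. The overlap relation sorts these rows, at the cost of the sign `ε`, into rows for
`μ` and rows for `ν` (`jt_expo_eq_of_isOverlap`). Expanding along the `l` rows of `μ` produces a sum
over `l`-subsets `S` (`det_sum_rows`). In each term, column operations eliminate the evaluation rows
and multiply the series by `∏_{s ∈ S} (1 - z_s T)`, which removes the variables of `S` from `H`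
(`det_eval_rows`, `prod_mul_hgen`). What remains is the determinant for the complement of `S`. The
weights, the minor and a Vandermonde determinant combine to the Littlewood-Schur function of `S`;
the parts of the weights that mix `S` with its complement form `1/Δ(T;S)` (`expand_term`). -/

/-- The coefficient of `t^β` for a vector `β` of exponents. -/
def vcoeff {R : Type*} [CommRing R] {L : ℕ} (β : Fin L → ℕ) : MvPolynomial (Fin L) R →ₗ[R] R :=
  MvPolynomial.lcoeff R (Finsupp.equivFunOnFinite.symm β)

theorem vcoeff_apply {R : Type*} [CommRing R] {L : ℕ} (β : Fin L → ℕ)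
    (f : MvPolynomial (Fin L) R) :
    vcoeff β f = MvPolynomial.coeff (Finsupp.equivFunOnFinite.symm β) f := rfl

theorem ext_vcoeff {R : Type*} [CommRing R] {L : ℕ} {f g : MvPolynomial (Fin L) R}
    (h : ∀ β, vcoeff β f = vcoeff β g) : f = g := by
  ext d
  have := h d
  rwa [vcoeff_apply, vcoeff_apply, Finsupp.equivFunOnFinite_symm_coe] at this

theorem vcoeff_prod_X_pow {R : Type*} [CommRing R] {L : ℕ} (β k : Fin L → ℕ) :
    vcoeff β (∏ a, (MvPolynomial.X a : MvPolynomial (Fin L) R) ^ k a) =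
      if k = β then 1 else 0 := by
  have : (∏ a, (MvPolynomial.X a : MvPolynomial (Fin L) R) ^ k a) =
      MvPolynomial.monomial (Finsupp.equivFunOnFinite.symm k) 1 := by
    rw [MvPolynomial.monomial_eq]
    simp [Finsupp.prod_fintype]
  rw [this, vcoeff_apply, MvPolynomial.coeff_monomial]
  simp

theorem vcoeff_prod_aeval {R : Type*} [CommRing R] {L : ℕ} (β : Fin L → ℕ)
    (Q : Fin L → Polynomial R) :
    vcoeff β (∏ a, Polynomial.aeval (MvPolynomial.X a : MvPolynomial (Fin L) R) (Q a)) =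
      ∏ a, (Q a).coeff (β a) := by
  classical
  have h1 : ∀ a, Polynomial.aeval (MvPolynomial.X a : MvPolynomial (Fin L) R) (Q a) =
      ∑ k ∈ (Q a).support, (Q a).coeff k • (MvPolynomial.X a : MvPolynomial (Fin L) R) ^ k := by
    intro a
    rw [Polynomial.aeval_def, Polynomial.eval₂_eq_sum, Polynomial.sum]
    simp [Algebra.smul_def]
  simp_rw [h1]
  rw [Finset.prod_univ_sum]
  simp_rw [Finset.prod_smul]
  rw [map_sum]
  simp_rw [map_smul, vcoeff_prod_X_pow, smul_eq_mul, mul_ite, mul_one, mul_zero]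
  rw [Finset.sum_ite_eq']
  split_ifs with h
  · rfl
  · rw [Fintype.mem_piFinset] at h
    push Not at h
    obtain ⟨a, ha⟩ := h
    rw [Polynomial.mem_support_iff, not_not] at ha
    exact (Finset.prod_eq_zero (Finset.mem_univ a) ha).symm

theorem vcoeff_det_aeval {R : Type*} [CommRing R] {L : ℕ} (β : Fin L → ℕ)
    (Q : Fin L → Polynomial R) :
    vcoeff β (Matrix.of fun a b : Fin L =>
      Polynomial.aeval (MvPolynomial.X a : MvPolynomial (Fin L) R) (Q b)).det =
      (Matrix.of fun a b : Fin L => (Q b).coeff (β a)).det := by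
  rw [← Matrix.det_transpose, Matrix.det_apply, map_sum, ← Matrix.det_transpose, Matrix.det_apply]
  refine Finset.sum_congr rfl fun σ _ => ?_
  have := vcoeff_prod_aeval β (fun a => Q (σ a))
  simp only [Matrix.transpose_apply, Matrix.of_apply] at this ⊢
  rw [Units.smul_def, Units.smul_def, map_zsmul, this]

/-- The alternant `det (t_a ^ α_b)`. -/
def alt {R : Type*} [CommRing R] {L : ℕ} (α : Fin L → ℕ) : MvPolynomial (Fin L) R :=
  (Matrix.of fun a b : Fin L => (MvPolynomial.X a : MvPolynomial (Fin L) R) ^ α b).det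

theorem vcoeff_alt {R : Type*} [CommRing R] {L : ℕ} (α β : Fin L → ℕ) :
    vcoeff β (alt α : MvPolynomial (Fin L) R) =
      (Matrix.of fun a b : Fin L => if β a = α b then (1 : R) else 0).det := by
  have := vcoeff_det_aeval (R := R) β (fun b => Polynomial.X ^ α b)
  simp only [map_pow, Polynomial.aeval_X, Polynomial.coeff_X_pow] at this
  exact this

theorem _root_.StrictAnti.eq_of_range_eq {L : ℕ} {α β : Fin L → ℕ} (hα : StrictAnti α)
    (hβ : StrictAnti β) (h : Set.range α = Set.range β) : α = β :=
  (StrictMono.range_inj (f := OrderDual.toDual ∘ α) (g := OrderDual.toDual ∘ β)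
    (fun _ _ h => hα h) (fun _ _ h => hβ h)).1 (by rw [Set.range_comp, Set.range_comp, h])

/-- Distinct strictly decreasing vectors of the same length have different ranges, so some entry of
`β` is missing from `α` and gives a zero row. Alternants are thus dual to the coefficients at
decreasing exponents. -/
theorem vcoeff_alt_of_strictAnti {R : Type*} [CommRing R] {L : ℕ} {α β : Fin L → ℕ}
    (hα : StrictAnti α) (hβ : StrictAnti β) :
    vcoeff β (alt α : MvPolynomial (Fin L) R) = if α = β then 1 else 0 := by
  rw [vcoeff_alt]
  split_ifs with h
  · subst h
    convert Matrix.det_one (R := R) (n := Fin L)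
    ext a b
    simp [Matrix.one_apply, hα.injective.eq_iff]
  · have : ∃ a, ∀ b, β a ≠ α b := by
      by_contra! hc
      apply h
      have hs : Set.range β ⊆ Set.range α := by
        rintro _ ⟨a, rfl⟩
        obtain ⟨b, hb⟩ := hc a
        exact ⟨b, hb.symm⟩
      have hs' : Set.range β = Set.range α :=
        Set.eq_of_subset_of_ncard_le hs (by
          rw [Set.ncard_range_of_injective hα.injective, Set.ncard_range_of_injective hβ.injective])
          (Set.finite_range α)
      exact hα.eq_of_range_eq hβ hs'.symm
    obtain ⟨a, ha⟩ := this
    exact Matrix.det_eq_zero_of_row_eq_zero a fun b => by simp [ha b]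

/-- The coefficients of `f` are antisymmetric under permutations of the exponents and vanish at
exponent vectors with repetitions. -/
def Antisymm {R : Type*} [CommRing R] {L : ℕ} (f : MvPolynomial (Fin L) R) : Prop :=
  (∀ (β : Fin L → ℕ) (σ : Equiv.Perm (Fin L)),
    vcoeff (β ∘ σ) f = ((Equiv.Perm.sign σ : ℤ) : R) * vcoeff β f) ∧
  ∀ β : Fin L → ℕ, ¬ Function.Injective β → vcoeff β f = 0

theorem antisymm_det_aeval {R : Type*} [CommRing R] {L : ℕ} (Q : Fin L → Polynomial R) :
    Antisymm (Matrix.of fun a b : Fin L =>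
      Polynomial.aeval (MvPolynomial.X a : MvPolynomial (Fin L) R) (Q b)).det := by
  refine ⟨fun β σ => ?_, fun β hβ => ?_⟩
  · rw [vcoeff_det_aeval, vcoeff_det_aeval, ← Matrix.det_permute]
    rfl
  · rw [vcoeff_det_aeval]
    simp only [Function.Injective, not_forall] at hβ
    obtain ⟨i, j, hij, hne⟩ := hβ
    refine Matrix.det_zero_of_row_eq hne ?_
    funext b
    simp [hij]

theorem antisymm_alt {R : Type*} [CommRing R] {L : ℕ} (α : Fin L → ℕ) :
    Antisymm (alt α : MvPolynomial (Fin L) R) := by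
  have := antisymm_det_aeval (R := R) (fun b => Polynomial.X ^ α b)
  simp only [map_pow, Polynomial.aeval_X] at this
  exact this

theorem Antisymm.sub {R : Type*} [CommRing R] {L : ℕ} {f g : MvPolynomial (Fin L) R}
    (hf : Antisymm f) (hg : Antisymm g) : Antisymm (f - g) :=
  ⟨fun β σ => by rw [map_sub, map_sub, hf.1, hg.1, mul_sub],
    fun β hβ => by rw [map_sub, hf.2 β hβ, hg.2 β hβ, sub_zero]⟩

theorem Antisymm.sum_smul {R : Type*} [CommRing R] {L : ℕ} {ι : Type*} (s : Finset ι)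
    (c : ι → R) {f : ι → MvPolynomial (Fin L) R} (hf : ∀ i, Antisymm (f i)) :
    Antisymm (∑ i ∈ s, c i • f i) := by
  refine ⟨fun β σ => ?_, fun β hβ => ?_⟩
  · simp only [map_sum, map_smul, smul_eq_mul, (hf _).1 β σ, Finset.mul_sum]
    exact Finset.sum_congr rfl fun i _ => by ring
  · simp only [map_sum, map_smul, smul_eq_mul, (hf _).2 β hβ, mul_zero, Finset.sum_const_zero]

theorem Antisymm.eq_zero {R : Type*} [CommRing R] {L : ℕ} {f : MvPolynomial (Fin L) R}
    (hf : Antisymm f) (h : ∀ β, StrictAnti β → vcoeff β f = 0) : f = 0 := by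
  refine ext_vcoeff fun β => ?_
  rw [map_zero]
  by_cases hβ : Function.Injective β
  · let σ : Equiv.Perm (Fin L) := Tuple.sort (OrderDual.toDual ∘ β)
    have hm : Monotone ((OrderDual.toDual ∘ β) ∘ σ) := Tuple.monotone_sort _
    have hs : StrictAnti (β ∘ σ) := by
      have h1 : Antitone (β ∘ σ) := fun i j hij => hm hij
      exact h1.strictAnti_of_injective (hβ.comp σ.injective)
    have h1 := hf.1 β σ
    rw [h _ hs] at h1
    rcases Int.units_eq_one_or (Equiv.Perm.sign σ) with h2 | h2 <;> rw [h2] at h1 <;> simpa using h1.symm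
  · exact hf.2 β hβ

/-! ### Exponent vectors of partitions -/

/-- The vector `λ + ρ_L`. -/
def expo (L : ℕ) (lam : YoungDiagram) : Fin L → ℕ := fun i => lam.rowLen i + (i.rev : ℕ)

theorem expo_strictAnti (L : ℕ) (lam : YoungDiagram) : StrictAnti (expo L lam) := by
  intro i j hij
  have := lam.rowLen_anti i j (by exact_mod_cast hij.le)
  have h : (i : ℕ) < j := hij
  simp only [expo, Fin.val_rev]
  omega

theorem colLen_le_iff {lam : YoungDiagram} {L : ℕ} :
    lam.colLen 0 ≤ L ↔ ∀ i, L ≤ i → lam.rowLen i = 0 := by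
  constructor
  · intro h i hi
    by_contra hc
    have : (i, 0) ∈ lam := YoungDiagram.mem_iff_lt_rowLen.2 (by omega)
    have := YoungDiagram.mem_iff_lt_colLen.1 this
    omega
  · intro h
    by_contra hc
    have : (L, 0) ∈ lam := YoungDiagram.mem_iff_lt_colLen.2 (by omega)
    have := YoungDiagram.mem_iff_lt_rowLen.1 this
    have := h L le_rfl
    omega

theorem ext_rowLen {lam μ : YoungDiagram} (h : ∀ i, lam.rowLen i = μ.rowLen i) : lam = μ := by
  ext ⟨i, j⟩
  rw [YoungDiagram.mem_cells, YoungDiagram.mem_cells, YoungDiagram.mem_iff_lt_rowLen,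
    YoungDiagram.mem_iff_lt_rowLen, h]

theorem expo_inj {L : ℕ} {lam μ : YoungDiagram} (hl : lam.colLen 0 ≤ L) (hm : μ.colLen 0 ≤ L)
    (h : expo L lam = expo L μ) : lam = μ := by
  refine ext_rowLen fun i => ?_
  by_cases hi : i < L
  · have := congrFun h ⟨i, hi⟩
    simpa [expo] using this
  · rw [colLen_le_iff.1 hl i (by omega), colLen_le_iff.1 hm i (by omega)]

theorem rowLen_ofSeq (f : ℕ → ℤ) (h : IsPartitionSeq f) (i : ℕ) :
    ((ofSeq f h).rowLen i : ℤ) = f i :=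
  congrFun (parts_ofSeq f h) i

/-- Subtracting `ρ_L` from a strictly decreasing vector leaves a weakly decreasing one, and its
entries are non-negative because `β` drops by at least one at each step. -/
theorem exists_expo_eq {L : ℕ} {β : Fin L → ℕ} (hβ : StrictAnti β) :
    ∃ lam : YoungDiagram, lam.colLen 0 ≤ L ∧ expo L lam = β := by
  have key : ∀ d : ℕ, ∀ i j : Fin L, (j : ℕ) = i + d → β j + d ≤ β i := by
    intro d
    induction d with
    | zero => intro i j h; rw [show j = i from Fin.ext h]; simp
    | succ d ih =>
      intro i j h
      have hj := j.2
      have h1 := ih i ⟨i + d, by omega⟩ rfl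
      have h2 : β j < β ⟨i + d, by omega⟩ := hβ (by rw [Fin.lt_def]; simp only; omega)
      omega
  have hrev : ∀ i : Fin L, (i.rev : ℕ) ≤ β i := by
    intro i
    have hi := i.2
    have := key (L - 1 - i) i ⟨L - 1, by omega⟩ (by simp only; omega)
    rw [Fin.val_rev]
    omega
  let f : ℕ → ℤ := fun i => if h : i < L then (β ⟨i, h⟩ : ℤ) - ((⟨i, h⟩ : Fin L).rev : ℕ) else 0
  have hf : IsPartitionSeq f := by
    refine ⟨?_, L, fun i hi => by simp [f, not_lt.2 hi]⟩
    intro i j hij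
    by_cases hj : j < L
    · have hi : i < L := by omega
      have := key (j - i) ⟨i, hi⟩ ⟨j, hj⟩ (by simp only; omega)
      simp only [f, hi, hj, dif_pos, Fin.val_rev]
      omega
    · simp only [f, hj, dif_neg, not_false_iff]
      split_ifs with hi
      · have := hrev ⟨i, hi⟩
        omega
      · exact le_rfl
  have hrow := rowLen_ofSeq f hf
  refine ⟨ofSeq f hf, colLen_le_iff.2 fun i hi => ?_, ?_⟩
  · have h1 := hrow i
    have h2 : f i = 0 := by simp [f, not_lt.2 hi]
    omega
  · funext i
    have h1 := hrow i
    have h2 : f i = (β i : ℤ) - (i.rev : ℕ) := by simp [f]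
    have h3 := hrev i
    simp only [expo]
    omega

/-- An antisymmetric polynomial is determined by its coefficients at decreasing exponents, that is,
at the vectors `λ + ρ_L`, and there the alternants form a dual basis. The set `B` only has to
contain the support. -/
theorem Antisymm.eq_sum {R : Type*} [CommRing R] {L : ℕ} {f : MvPolynomial (Fin L) R}
    (hf : Antisymm f) (B : Finset YoungDiagram) (hB : ∀ lam ∈ B, lam.colLen 0 ≤ L)
    (h : ∀ lam : YoungDiagram, lam.colLen 0 ≤ L → vcoeff (expo L lam) f ≠ 0 → lam ∈ B) :
    f = ∑ lam ∈ B, vcoeff (expo L lam) f • alt (expo L lam) := by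
  rw [← sub_eq_zero]
  refine (hf.sub (Antisymm.sum_smul _ _ fun lam => antisymm_alt _)).eq_zero fun β hβ => ?_
  obtain ⟨lam, hlam, rfl⟩ := exists_expo_eq hβ
  rw [map_sub, sub_eq_zero, map_sum]
  simp only [map_smul, smul_eq_mul, vcoeff_alt_of_strictAnti (expo_strictAnti _ _) hβ, mul_ite,
    mul_one, mul_zero]
  rw [Finset.sum_ite, Finset.sum_const_zero, add_zero]
  by_cases hl : lam ∈ B
  · rw [Finset.sum_eq_single_of_mem lam (by simp [hl])]
    intro μ hμ hne
    rw [Finset.mem_filter] at hμ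
    exact absurd (expo_inj (hB μ hμ.1) hlam hμ.2) hne
  · have h0 : vcoeff (expo L lam) f = 0 := by
      by_contra hc
      exact hl (h lam hlam hc)
    rw [h0]
    refine (Finset.sum_eq_zero fun μ hμ => ?_).symm
    rw [Finset.mem_filter] at hμ
    rw [hμ.2, h0]

/-! ### Schur polynomials -/

theorem delta_eq_det {R : Type*} [CommRing R] {n : ℕ} (x : Fin n → R) :
    delta x = (Matrix.of fun a b : Fin n => x a ^ (b.rev : ℕ)).det := by
  have h := Matrix.det_vandermonde (fun i : Fin n => x i.rev)
  have h2 : (Matrix.of fun a b : Fin n => x a ^ (b.rev : ℕ)).det =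
      (Matrix.vandermonde fun i : Fin n => x i.rev).det := by
    rw [← Matrix.det_submatrix_equiv_self Fin.revPerm]
    congr 1
    ext i j
    simp only [Matrix.submatrix_apply, Matrix.of_apply, Matrix.vandermonde_apply, Fin.revPerm_apply,
      Fin.rev_rev]
  rw [h2, h, delta, Finset.prod_sigma', Finset.prod_sigma']
  refine Finset.prod_bij' (fun p _ => ⟨p.2.rev, p.1.rev⟩) (fun p _ => ⟨p.2.rev, p.1.rev⟩)
    ?_ ?_ ?_ ?_ ?_
  · rintro ⟨i, j⟩ h; simpa using h
  · rintro ⟨i, j⟩ h; simpa using h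
  · rintro ⟨i, j⟩ h; simp
  · rintro ⟨i, j⟩ h; simp
  · rintro ⟨i, j⟩ h; simp

theorem map_delta {R S : Type*} [CommRing R] [CommRing S] (φ : R →+* S) {n : ℕ} (x : Fin n → R) :
    φ (delta x) = delta (φ ∘ x) := by
  simp [delta, map_prod]

theorem delta_X_eq_alt (R : Type*) [CommRing R] (n : ℕ) :
    delta (MvPolynomial.X : Fin n → MvPolynomial (Fin n) R) = alt (fun b => (b.rev : ℕ)) :=
  delta_eq_det _

theorem delta_ne_zero {R : Type*} [CommRing R] [IsDomain R] {n : ℕ} {x : Fin n → R}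
    (hx : Function.Injective x) : delta x ≠ 0 := by
  rw [delta, Finset.prod_ne_zero_iff]
  intro i _
  rw [Finset.prod_ne_zero_iff]
  intro j hj
  rw [Finset.mem_Ioi] at hj
  exact sub_ne_zero.2 (hx.ne hj.ne)

theorem delta_X_ne_zero (R : Type*) [CommRing R] [IsDomain R] (n : ℕ) :
    delta (MvPolynomial.X : Fin n → MvPolynomial (Fin n) R) ≠ 0 :=
  delta_ne_zero (MvPolynomial.X_injective)

theorem schurPoly_eq_zero {n : ℕ} {lam : YoungDiagram} (h : n < lam.colLen 0) :
    schurPoly n lam = 0 := if_pos h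

theorem delta_mul_schurPoly {n : ℕ} {lam : YoungDiagram} (h : lam.colLen 0 ≤ n) :
    delta (MvPolynomial.X : Fin n → MvPolynomial (Fin n) ℤ) * schurPoly n lam =
      alt (expo n lam) := by
  rw [schurPoly, if_neg (not_lt.2 h)]
  exact (delta_dvd_alternant n lam).choose_spec.symm

theorem map_alt {R S : Type*} [CommRing R] [CommRing S] {n : ℕ} (α : Fin n → ℕ)
    (φ : MvPolynomial (Fin n) R →+* S) :
    φ (alt α) = (Matrix.of fun a b : Fin n => φ (MvPolynomial.X a) ^ α b).det := by
  rw [alt, RingHom.map_det]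
  congr 1
  ext i j
  simp

theorem delta_mul_schur {R : Type*} [CommRing R] {n : ℕ} {lam : YoungDiagram}
    (h : lam.colLen 0 ≤ n) (x : Fin n → R) :
    delta x * schur lam x = (Matrix.of fun a b : Fin n => x a ^ expo n lam b).det := by
  have := congrArg (MvPolynomial.aeval x : MvPolynomial (Fin n) ℤ →ₐ[ℤ] R).toRingHom
    (delta_mul_schurPoly h)
  rw [map_mul, map_delta, map_alt] at this
  have h2 : ((MvPolynomial.aeval x : MvPolynomial (Fin n) ℤ →ₐ[ℤ] R).toRingHom : _ → R) ∘
    MvPolynomial.X = x := by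
    funext i
    simp
  rw [h2] at this
  refine this.trans ?_
  simp

theorem schur_eq_zero {R : Type*} [CommRing R] {n : ℕ} {lam : YoungDiagram}
    (h : n < lam.colLen 0) (x : Fin n → R) : schur lam x = 0 := by
  rw [schur, schurPoly_eq_zero h, map_zero]

theorem map_schurPoly {R : Type*} [CommRing R] {n : ℕ} (lam : YoungDiagram) :
    MvPolynomial.map (Int.castRingHom R) (schurPoly n lam) =
      schur lam (MvPolynomial.X : Fin n → MvPolynomial (Fin n) R) := by
  have : MvPolynomial.map (Int.castRingHom R) =
      (MvPolynomial.aeval (MvPolynomial.X : Fin n → MvPolynomial (Fin n) R)).toRingHom := by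
    refine MvPolynomial.ringHom_ext (fun r => ?_) fun i => ?_
    · simp
    · simp
  exact RingHom.congr_fun this _

/-! ### Homogeneity -/

theorem alt_isHomogeneous {R : Type*} [CommRing R] {n : ℕ} (α : Fin n → ℕ) :
    (alt α : MvPolynomial (Fin n) R).IsHomogeneous (∑ i, α i) := by
  rw [alt, Matrix.det_apply, ← MvPolynomial.mem_homogeneousSubmodule]
  refine Submodule.sum_mem _ fun σ _ => ?_
  rw [Units.smul_def]
  refine zsmul_mem ?_ _
  rw [MvPolynomial.mem_homogeneousSubmodule]
  refine MvPolynomial.IsHomogeneous.prod _ _ _ fun i _ => ?_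
  simpa using (MvPolynomial.isHomogeneous_X R (σ i)).pow (α i)

/-- The component of `f` in degree `d.degree`, multiplied by `g`, is the component of `f * g` in
degree `d.degree + j`. If that degree is not `D` the product is zero, and `g` cancels. -/
theorem degree_of_isHomogeneous_mul {σ R : Type*} [CommRing R] [IsDomain R]
    {f g : MvPolynomial σ R} {D j : ℕ} (hfg : (f * g).IsHomogeneous D) (hg : g.IsHomogeneous j)
    (hg0 : g ≠ 0) {d : σ →₀ ℕ} (hd : MvPolynomial.coeff d f ≠ 0) : d.degree + j = D := by
  classical
  let _ := MvPolynomial.gradedAlgebra (σ := σ) (R := R)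
  by_contra hne
  have h1 := DirectSum.coe_decompose_mul_add_of_right_mem (MvPolynomial.homogeneousSubmodule σ R)
    (a := f) (i := d.degree) ((MvPolynomial.mem_homogeneousSubmodule j g).2 hg)
  rw [DirectSum.decompose_of_mem_ne _ ((MvPolynomial.mem_homogeneousSubmodule D _).2 hfg)
    (Ne.symm hne)] at h1
  have h2 : (DirectSum.decompose (MvPolynomial.homogeneousSubmodule σ R) f d.degree :
      MvPolynomial σ R) = MvPolynomial.homogeneousComponent d.degree f :=
    MvPolynomial.decomposition.decompose'_apply _ _
  rw [h2] at h1
  have h3 := (mul_eq_zero.1 h1.symm).resolve_right hg0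
  have h4 := congrArg (MvPolynomial.coeff d) h3
  rw [MvPolynomial.coeff_homogeneousComponent, if_pos rfl, MvPolynomial.coeff_zero] at h4
  exact hd h4

/-- `Δ s_μ s_ν` in `n` variables. -/
def deltaSchurMul (n : ℕ) (μ ν : YoungDiagram) : MvPolynomial (Fin n) ℤ :=
  delta (MvPolynomial.X : Fin n → MvPolynomial (Fin n) ℤ) * (schurPoly n μ * schurPoly n ν)

/-- A second factor `Δ` turns both Schur polynomials into alternants. Homogeneity and antisymmetry
of `Δ s_μ s_ν` are then inherited by cancelling that factor. -/
theorem deltaSchurMul_mul_delta {n : ℕ} {μ ν : YoungDiagram} (hμ : μ.colLen 0 ≤ n)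
    (hν : ν.colLen 0 ≤ n) :
    deltaSchurMul n μ ν * delta (MvPolynomial.X : Fin n → MvPolynomial (Fin n) ℤ) =
      alt (expo n μ) * alt (expo n ν) := by
  rw [← delta_mul_schurPoly hμ, ← delta_mul_schurPoly hν, deltaSchurMul]
  ring

theorem card_eq_sum_rowLen {lam : YoungDiagram} {n : ℕ} (h : lam.colLen 0 ≤ n) :
    lam.card = ∑ i : Fin n, lam.rowLen i := by
  rw [YoungDiagram.card, Finset.card_eq_sum_card_fiberwise (f := Prod.fst) (t := Finset.range n),
    Finset.sum_range]
  · refine Finset.sum_congr rfl fun i _ => ?_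
    rw [YoungDiagram.rowLen_eq_card, YoungDiagram.row]
  · intro c hc
    have h1 : (c.1, c.2) ∈ lam := hc
    have h2 := YoungDiagram.mem_iff_lt_rowLen.1 h1
    rw [Finset.coe_range, Set.mem_Iio]
    by_contra h3
    rw [colLen_le_iff.1 h c.1 (by omega)] at h2
    omega

theorem card_of_vcoeff_deltaSchurMul_ne_zero {n : ℕ} {μ ν lam : YoungDiagram}
    (hlam : lam.colLen 0 ≤ n)
    (h : vcoeff (expo n lam) (deltaSchurMul n μ ν) ≠ 0) : lam.card = μ.card + ν.card := by
  have hμ : μ.colLen 0 ≤ n := by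
    by_contra hc
    rw [deltaSchurMul, schurPoly_eq_zero (by omega), zero_mul, mul_zero, map_zero] at h
    exact h rfl
  have hν : ν.colLen 0 ≤ n := by
    by_contra hc
    rw [deltaSchurMul, schurPoly_eq_zero (lam := ν) (by omega), mul_zero, mul_zero, map_zero] at h
    exact h rfl
  have h1 := degree_of_isHomogeneous_mul (f := deltaSchurMul n μ ν)
    (g := delta (MvPolynomial.X : Fin n → MvPolynomial (Fin n) ℤ))
    (by rw [deltaSchurMul_mul_delta hμ hν]
        exact (alt_isHomogeneous _).mul (alt_isHomogeneous _))
    (by rw [delta_X_eq_alt]; exact alt_isHomogeneous _) (delta_X_ne_zero ℤ n) h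
  rw [Finsupp.degree_eq_sum] at h1
  simp only [Finsupp.coe_equivFunOnFinite_symm, expo, Finset.sum_add_distrib] at h1
  rw [card_eq_sum_rowLen hlam, card_eq_sum_rowLen hμ, card_eq_sum_rowLen hν]
  omega

/-! ### Antisymmetry of `Δ s_μ s_ν` -/

theorem rename_alt {n : ℕ} (α : Fin n → ℕ) (σ : Equiv.Perm (Fin n)) :
    MvPolynomial.rename σ (alt α : MvPolynomial (Fin n) ℤ) =
      ((Equiv.Perm.sign σ : ℤ) : MvPolynomial (Fin n) ℤ) * alt α := by
  have h := map_alt α (MvPolynomial.rename σ : MvPolynomial (Fin n) ℤ →ₐ[ℤ] _).toRingHom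
  rw [alt, ← Matrix.det_permute]
  refine h.trans ?_
  congr 1
  ext i j
  simp

theorem antisymm_of_rename {n : ℕ} {f : MvPolynomial (Fin n) ℤ}
    (hf : ∀ σ : Equiv.Perm (Fin n), MvPolynomial.rename σ f =
      ((Equiv.Perm.sign σ : ℤ) : MvPolynomial (Fin n) ℤ) * f) : Antisymm f := by
  have key : ∀ (β : Fin n → ℕ) (σ : Equiv.Perm (Fin n)),
      vcoeff (β ∘ σ) f = ((Equiv.Perm.sign σ : ℤ) : ℤ) * vcoeff β f := by
    intro β σ
    have h1 := MvPolynomial.coeff_rename_mapDomain σ σ.injective f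
      (Finsupp.equivFunOnFinite.symm (β ∘ σ))
    have h2 : Finsupp.mapDomain σ (Finsupp.equivFunOnFinite.symm (β ∘ σ)) =
        Finsupp.equivFunOnFinite.symm β := by
      ext i
      rw [← Finsupp.equivMapDomain_eq_mapDomain, Finsupp.equivMapDomain_apply]
      simp
    rw [h2, hf σ] at h1
    rw [vcoeff_apply, ← h1, vcoeff_apply, ← map_intCast (MvPolynomial.C : ℤ →+* _),
      MvPolynomial.coeff_C_mul]
    rfl
  refine ⟨key, fun β hβ => ?_⟩
  simp only [Function.Injective, not_forall] at hβ
  obtain ⟨i, j, hij, hne⟩ := hβ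
  -- Swapping two equal exponents fixes `β` but changes the sign, so the coefficient is its own
  -- negative; over `ℤ` it vanishes.
  have h := key β (Equiv.swap i j)
  rw [Equiv.Perm.sign_swap hne, show β ∘ Equiv.swap i j = β from ?_] at h
  · simp only [Units.val_neg, Units.val_one] at h
    omega
  · funext a
    simp only [Function.comp_apply, Equiv.swap_apply_def]
    split_ifs with h1 h2
    · rw [h1, hij]
    · rw [h2, hij]
    · rfl

theorem antisymm_deltaSchurMul (n : ℕ) (μ ν : YoungDiagram) :
    Antisymm (deltaSchurMul n μ ν) := by
  by_cases hμ : μ.colLen 0 ≤ n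
  swap
  · rw [deltaSchurMul, schurPoly_eq_zero (by omega), zero_mul, mul_zero]
    exact ⟨fun _ _ => by simp, fun _ _ => by simp⟩
  by_cases hν : ν.colLen 0 ≤ n
  swap
  · rw [deltaSchurMul, schurPoly_eq_zero (lam := ν) (by omega), mul_zero, mul_zero]
    exact ⟨fun _ _ => by simp, fun _ _ => by simp⟩
  refine antisymm_of_rename fun σ => ?_
  have h1 := deltaSchurMul_mul_delta hμ hν
  have h2 := congrArg (MvPolynomial.rename σ) h1
  rw [map_mul, map_mul, delta_X_eq_alt, rename_alt, rename_alt, rename_alt] at h2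
  refine mul_right_cancel₀ (delta_X_ne_zero ℤ n) ?_
  rw [mul_assoc, h1, delta_X_eq_alt]
  set ε := ((Equiv.Perm.sign σ : ℤ) : MvPolynomial (Fin n) ℤ) with hε
  have h3 : ε * ε = 1 := by
    rw [hε, ← Int.cast_mul, ← Units.val_mul, Int.units_mul_self]
    simp
  linear_combination ε * h2 - (MvPolynomial.rename σ (deltaSchurMul n μ ν) *
    alt (fun b => (b.rev : ℕ)) - ε * alt (expo n μ) * alt (expo n ν)) * h3

/-! ### Existence of the Littlewood-Richardson coefficients -/

/-- Setting the last variable to zero. -/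
def restrictLast (n : ℕ) : MvPolynomial (Fin (n + 1)) ℤ →ₐ[ℤ] MvPolynomial (Fin n) ℤ :=
  MvPolynomial.aeval (Fin.snoc MvPolynomial.X 0 : Fin (n + 1) → MvPolynomial (Fin n) ℤ)

/-- The last row becomes `0 ^ α b`, which can be nonzero only in the last column; every row of the
remaining minor contains a factor `X i`. -/
theorem restrictLast_alt {n : ℕ} (α : Fin (n + 1) → ℕ) (γ : Fin n → ℕ)
    (h : ∀ j : Fin n, α j.castSucc = γ j + 1) :
    restrictLast n (alt α) =
      if α (Fin.last n) = 0 then (∏ i, MvPolynomial.X i) * alt γ else 0 := by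
  have h1 : restrictLast n (alt α) = (Matrix.of fun a b : Fin (n + 1) =>
      (Fin.snoc MvPolynomial.X 0 : Fin (n + 1) → MvPolynomial (Fin n) ℤ) a ^ α b).det := by
    refine (map_alt α (restrictLast n).toRingHom).trans ?_
    congr 1
    ext i j
    simp [restrictLast]
  rw [h1, Matrix.det_succ_row _ (Fin.last n), Fin.sum_univ_castSucc]
  rw [Finset.sum_eq_zero, zero_add]
  · simp only [Matrix.of_apply, Fin.snoc_last]
    split_ifs with h0
    · have h2 : (-1 : MvPolynomial (Fin n) ℤ) ^ ((Fin.last n : ℕ) + (Fin.last n : ℕ)) = 1 :=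
        Even.neg_one_pow ⟨_, rfl⟩
      rw [h2, h0, pow_zero, one_mul, one_mul, alt, ← Matrix.det_mul_column]
      congr 1
      refine Matrix.ext fun i j => ?_
      simp [Fin.succAbove_last, h, pow_succ']
    · rw [zero_pow h0, mul_zero, zero_mul]
  · intro j _
    simp [h]

theorem restrictLast_schurPoly (n : ℕ) (lam : YoungDiagram) :
    restrictLast n (schurPoly (n + 1) lam) = schurPoly n lam := by
  by_cases h : lam.colLen 0 ≤ n + 1
  swap
  · rw [schurPoly_eq_zero (by omega), schurPoly_eq_zero (by omega), map_zero]
  have hX : (∏ i, MvPolynomial.X i : MvPolynomial (Fin n) ℤ) ≠ 0 :=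
    Finset.prod_ne_zero_iff.2 fun i _ => MvPolynomial.X_ne_zero i
  have h1 := congrArg (restrictLast n) (delta_mul_schurPoly h)
  rw [map_mul, delta_X_eq_alt, restrictLast_alt _ (fun b => (b.rev : ℕ)) (by
      intro j; simp only [Fin.val_rev, Fin.val_castSucc]; have := j.2; omega),
    if_pos (by simp), restrictLast_alt _ (expo n lam) (by
      intro j; simp only [expo, Fin.val_rev, Fin.val_castSucc]; have := j.2; omega),
    ← delta_X_eq_alt] at h1
  have h2 : expo (n + 1) lam (Fin.last n) = lam.rowLen n := by simp [expo]
  refine mul_left_cancel₀ (mul_ne_zero hX (delta_X_ne_zero ℤ n)) (h1.trans ?_)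
  rw [h2]
  by_cases hn : lam.colLen 0 ≤ n
  · rw [if_pos (colLen_le_iff.1 hn n le_rfl), mul_assoc, delta_mul_schurPoly hn]
  · rw [schurPoly_eq_zero (by omega), mul_zero, if_neg]
    have : (n, 0) ∈ lam := YoungDiagram.mem_iff_lt_colLen.2 (by omega)
    have := YoungDiagram.mem_iff_lt_rowLen.1 this
    omega

theorem vcoeff_delta_mul_sum {n : ℕ} {lam : YoungDiagram} (hlam : lam.colLen 0 ≤ n)
    (c : YoungDiagram →₀ ℤ) :
    vcoeff (expo n lam) (delta (MvPolynomial.X : Fin n → MvPolynomial (Fin n) ℤ) *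
      c.sum fun κ a => a • schurPoly n κ) = c lam := by
  classical
  rw [Finsupp.sum, Finset.mul_sum, map_sum]
  have key : ∀ κ, vcoeff (expo n lam) (delta (MvPolynomial.X : Fin n → MvPolynomial (Fin n) ℤ) *
      c κ • schurPoly n κ) = if κ = lam then c κ else 0 := by
    intro κ
    rw [mul_smul_comm, map_smul]
    by_cases hκ : κ.colLen 0 ≤ n
    · rw [delta_mul_schurPoly hκ,
        vcoeff_alt_of_strictAnti (expo_strictAnti _ _) (expo_strictAnti _ _)]
      have : expo n κ = expo n lam ↔ κ = lam := ⟨expo_inj hκ hlam, fun h => by rw [h]⟩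
      simp [this]
    · rw [schurPoly_eq_zero (by omega), mul_zero, map_zero, smul_zero, if_neg]
      rintro rfl
      exact hκ hlam
  simp_rw [key]
  rw [Finset.sum_ite_eq']
  split_ifs with h
  · rfl
  · exact (Finsupp.notMem_support_iff.1 h).symm

theorem colLen_zero_le_card (lam : YoungDiagram) : lam.colLen 0 ≤ lam.card := by
  rw [YoungDiagram.colLen_eq_card]
  exact Finset.card_le_card (Finset.filter_subset _ _)

/-- The expansion of `Δ s_μ s_ν` in alternants, divided by `Δ`. The length bound follows from
homogeneity and does not depend on `n`, which is what allows the expansions for different `n` to be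
compared. -/
theorem exists_schurPoly_mul_eq (n : ℕ) (μ ν : YoungDiagram) :
    ∃ c : YoungDiagram →₀ ℤ, (∀ lam, c lam ≠ 0 → lam.colLen 0 ≤ μ.card + ν.card) ∧
      schurPoly n μ * schurPoly n ν = c.sum fun lam a => a • schurPoly n lam := by
  classical
  have hfin : {lam : YoungDiagram | lam.colLen 0 ≤ n ∧
      vcoeff (expo n lam) (deltaSchurMul n μ ν) ≠ 0}.Finite := by
    refine Set.Finite.of_injOn (f := fun lam => Finsupp.equivFunOnFinite.symm (expo n lam))
      (t := ((deltaSchurMul n μ ν).support : Set (Fin n →₀ ℕ))) ?_ ?_ (Finset.finite_toSet _)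
    · intro lam hlam
      rw [Finset.mem_coe, MvPolynomial.mem_support_iff]
      exact hlam.2
    · intro κ hκ lam hlam h
      exact expo_inj hκ.1 hlam.1 (Finsupp.equivFunOnFinite.symm.injective h)
  set B := hfin.toFinset with hB
  have hmem : ∀ lam, lam ∈ B ↔ lam.colLen 0 ≤ n ∧
      vcoeff (expo n lam) (deltaSchurMul n μ ν) ≠ 0 := by
    intro lam
    rw [hB, Set.Finite.mem_toFinset]
    rfl
  have h1 := (antisymm_deltaSchurMul n μ ν).eq_sum B (fun lam h => ((hmem lam).1 h).1)
    (fun lam h h' => (hmem lam).2 ⟨h, h'⟩)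
  let f : YoungDiagram → ℤ := fun lam =>
    if lam ∈ B then vcoeff (expo n lam) (deltaSchurMul n μ ν) else 0
  refine ⟨Finsupp.onFinset B f fun lam h => ?_, fun lam h => ?_, ?_⟩
  · by_contra hc
    exact h (if_neg hc)
  · have hl : lam ∈ B := by
      by_contra hc
      exact h (if_neg hc)
    rw [hmem] at hl
    rw [← card_of_vcoeff_deltaSchurMul_ne_zero hl.1 hl.2]
    exact colLen_zero_le_card lam
  · refine mul_left_cancel₀ (delta_X_ne_zero ℤ n) (h1.trans ?_)
    rw [Finsupp.onFinset_sum (g := fun lam a => a • schurPoly n lam) _ fun lam => zero_smul _ _,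
      Finset.mul_sum]
    refine Finset.sum_congr rfl fun lam hl => ?_
    rw [mul_smul_comm, delta_mul_schurPoly ((hmem lam).1 hl).1]
    simp only [f, if_pos hl]

theorem schurPoly_mul_eq_of_le {μ ν : YoungDiagram} {c : YoungDiagram →₀ ℤ} {n N : ℕ} (h : n ≤ N)
    (hc : schurPoly N μ * schurPoly N ν = c.sum fun lam a => a • schurPoly N lam) :
    schurPoly n μ * schurPoly n ν = c.sum fun lam a => a • schurPoly n lam := by
  induction N, h using Nat.le_induction with
  | base => exact hc
  | succ N _ ih =>
    refine ih ?_
    have := congrArg (restrictLast N) hc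
    rw [map_mul, map_finsuppSum] at this
    simpa only [map_smul, restrictLast_schurPoly] using this

/-- The coefficients found for `N = |μ| + |ν|` variables serve for all `n`: for smaller `n` set
variables to zero; for larger `n` restrict to `N` variables, where no admissible `s_λ` vanishes and
uniqueness applies. -/
theorem exists_lrCoeff (μ ν : YoungDiagram) :
    ∃ c : YoungDiagram →₀ ℤ, ∀ n : ℕ,
      schurPoly n μ * schurPoly n ν = c.sum fun lam a => a • schurPoly n lam := by
  set N := μ.card + ν.card
  obtain ⟨c, hc, h⟩ := exists_schurPoly_mul_eq N μ ν
  refine ⟨c, fun n => ?_⟩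
  by_cases hn : n ≤ N
  · exact schurPoly_mul_eq_of_le hn h
  · obtain ⟨c', hc', h'⟩ := exists_schurPoly_mul_eq n μ ν
    have h'' := schurPoly_mul_eq_of_le (not_le.1 hn).le h'
    have : c' = c := by
      ext lam
      by_cases hl : lam.colLen 0 ≤ N
      · rw [← vcoeff_delta_mul_sum hl c, ← vcoeff_delta_mul_sum hl c', ← h, ← h'']
      · have h1 : c lam = 0 := by
          by_contra h0
          exact hl (hc lam h0)
        have h2 : c' lam = 0 := by
          by_contra h0
          exact hl (hc' lam h0)
        rw [h1, h2]
    rw [← this]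
    exact h'

/-- The only access to the chosen coefficients used later: any number of variables that accommodates
`λ` computes them. -/
theorem lrCoeff_eq_vcoeff {n : ℕ} {lam : YoungDiagram} (hlam : lam.colLen 0 ≤ n)
    (μ ν : YoungDiagram) :
    lrCoeff μ ν lam = vcoeff (expo n lam) (deltaSchurMul n μ ν) := by
  rw [lrCoeff, dif_pos (exists_lrCoeff μ ν), deltaSchurMul,
    (exists_lrCoeff μ ν).choose_spec n, vcoeff_delta_mul_sum hlam]

/-! ### Jacobi-Trudi determinants and the Cauchy identity -/

/-- The Jacobi-Trudi determinant of a power series at a vector of exponents. -/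
def jt {R : Type*} [CommRing R] (f : PowerSeries R) {L : ℕ} (α : Fin L → ℕ) : R :=
  (Matrix.of fun i j : Fin L => PowerSeries.coeff (α i) (PowerSeries.X ^ (j.rev : ℕ) * f)).det

theorem coeff_mul_congr {R : Type*} [CommRing R] {f g : PowerSeries R} {N : ℕ}
    (h : ∀ k ≤ N, PowerSeries.coeff k f = PowerSeries.coeff k g) (a : PowerSeries R) :
    ∀ k ≤ N, PowerSeries.coeff k (a * f) = PowerSeries.coeff k (a * g) := by
  intro k hk
  rw [PowerSeries.coeff_mul, PowerSeries.coeff_mul]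
  refine Finset.sum_congr rfl fun p hp => ?_
  rw [Finset.HasAntidiagonal.mem_antidiagonal] at hp
  rw [h _ (by omega)]

theorem jt_congr {R : Type*} [CommRing R] {f g : PowerSeries R} {N : ℕ}
    (h : ∀ k ≤ N, PowerSeries.coeff k f = PowerSeries.coeff k g) {L : ℕ} {α : Fin L → ℕ}
    (hα : ∀ i, α i ≤ N) : jt f α = jt g α := by
  unfold jt
  congr 1
  ext i j
  exact coeff_mul_congr h _ _ (hα i)

theorem delta_mul_prod_aeval {R : Type*} [CommRing R] (L : ℕ) (P : Polynomial R) :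
    delta (MvPolynomial.X : Fin L → MvPolynomial (Fin L) R) *
      ∏ a, Polynomial.aeval (MvPolynomial.X a : MvPolynomial (Fin L) R) P =
    (Matrix.of fun a b : Fin L => Polynomial.aeval (MvPolynomial.X a : MvPolynomial (Fin L) R)
      (Polynomial.X ^ (b.rev : ℕ) * P)).det := by
  rw [delta_eq_det, mul_comm, ← Matrix.det_mul_column]
  congr 1
  ext1 i j
  simp [mul_comm]

/-- Multiplying row `a` of the Vandermonde matrix by `P(t_a)` leaves one variable per row, so the
coefficient is extracted row by row. -/
theorem vcoeff_delta_mul_prod_aeval {R : Type*} [CommRing R] {L : ℕ} (α : Fin L → ℕ)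
    (P : Polynomial R) :
    vcoeff α (delta (MvPolynomial.X : Fin L → MvPolynomial (Fin L) R) *
      ∏ a, Polynomial.aeval (MvPolynomial.X a : MvPolynomial (Fin L) R) P) =
    jt (P : PowerSeries R) α := by
  rw [delta_mul_prod_aeval, vcoeff_det_aeval, jt]
  congr 1
  ext i j
  simp only [Matrix.of_apply]
  rw [← Polynomial.coe_X, ← Polynomial.coe_pow, ← Polynomial.coe_mul, Polynomial.coeff_coe]

theorem finite_box (L D : ℕ) :
    {lam : YoungDiagram | lam.colLen 0 ≤ L ∧ lam.rowLen 0 ≤ D}.Finite := by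
  refine Set.Finite.of_injOn (f := YoungDiagram.cells)
    (t := ((Finset.range L ×ˢ Finset.range D).powerset : Set (Finset (ℕ × ℕ)))) ?_ ?_
    (Finset.finite_toSet _)
  · rintro lam ⟨h1, h2⟩
    rw [Finset.mem_coe, Finset.mem_powerset]
    rintro ⟨i, j⟩ hc
    rw [YoungDiagram.mem_cells] at hc
    have h3 := YoungDiagram.mem_iff_lt_colLen.1 hc
    have h4 := YoungDiagram.mem_iff_lt_rowLen.1 hc
    have h5 := lam.colLen_anti 0 j (Nat.zero_le _)
    have h6 := lam.rowLen_anti 0 i (Nat.zero_le _)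
    rw [Finset.mem_product, Finset.mem_range, Finset.mem_range]
    exact ⟨by omega, by omega⟩
  · intro κ _ lam _ h
    exact YoungDiagram.ext h

/-- The partitions with at most `L` parts, all of them at most `D`. -/
def box (L D : ℕ) : Finset YoungDiagram := (finite_box L D).toFinset

theorem mem_box {L D : ℕ} {lam : YoungDiagram} :
    lam ∈ box L D ↔ lam.colLen 0 ≤ L ∧ lam.rowLen 0 ≤ D := by
  rw [box, Set.Finite.mem_toFinset]
  rfl

theorem jt_coe_eq_zero {R : Type*} [CommRing R] {L D : ℕ} {P : Polynomial R}
    (hP : P.natDegree ≤ D) {lam : YoungDiagram} (hlam : lam.colLen 0 ≤ L) (h : D < lam.rowLen 0) :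
    jt (P : PowerSeries R) (expo L lam) = 0 := by
  have hL : 0 < L := by
    by_contra hc
    rw [colLen_le_iff.1 hlam 0 (by omega)] at h
    omega
  refine Matrix.det_eq_zero_of_row_eq_zero ⟨0, hL⟩ fun j => ?_
  simp only [Matrix.of_apply]
  rw [← Polynomial.coe_X, ← Polynomial.coe_pow, ← Polynomial.coe_mul, Polynomial.coeff_coe]
  refine Polynomial.coeff_eq_zero_of_natDegree_lt ?_
  refine (Polynomial.natDegree_mul_le.trans
    (Nat.add_le_add (Polynomial.natDegree_X_pow_le _) hP)).trans_lt ?_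
  have := j.2
  simp only [expo, Fin.val_rev]
  omega

theorem cauchy_identity {R : Type*} [CommRing R] [IsDomain R] (L : ℕ) {D : ℕ} {P : Polynomial R}
    (hP : P.natDegree ≤ D) :
    ∏ a, Polynomial.aeval (MvPolynomial.X a : MvPolynomial (Fin L) R) P =
      ∑ lam ∈ box L D, jt (P : PowerSeries R) (expo L lam) •
        schur lam (MvPolynomial.X : Fin L → MvPolynomial (Fin L) R) := by
  refine mul_left_cancel₀ (delta_X_ne_zero R L) ?_
  have h := (antisymm_det_aeval (fun b : Fin L => Polynomial.X ^ (b.rev : ℕ) * P)).eq_sum (box L D)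
    (fun lam h => (mem_box.1 h).1) (fun lam hl h => mem_box.2 ⟨hl, by
      by_contra hc
      rw [← delta_mul_prod_aeval, vcoeff_delta_mul_prod_aeval] at h
      exact h (jt_coe_eq_zero hP hl (by omega))⟩)
  rw [← delta_mul_prod_aeval] at h
  refine h.trans ?_
  rw [Finset.mul_sum]
  refine Finset.sum_congr rfl fun lam hl => ?_
  rw [vcoeff_delta_mul_prod_aeval, mul_smul_comm, delta_mul_schur (mem_box.1 hl).1]
  rfl

/-! ### From Littlewood-Richardson coefficients to Littlewood-Schur functions -/

theorem intCast_lrCoeff {R : Type*} [CommRing R] {L : ℕ} {lam : YoungDiagram}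
    (hlam : lam.colLen 0 ≤ L) (μ ν : YoungDiagram) :
    (lrCoeff μ ν lam : R) = vcoeff (expo L lam)
      (delta (MvPolynomial.X : Fin L → MvPolynomial (Fin L) R) *
        (schur μ MvPolynomial.X * schur ν MvPolynomial.X)) := by
  rw [lrCoeff_eq_vcoeff hlam, ← map_schurPoly, ← map_schurPoly, vcoeff_apply, vcoeff_apply,
    deltaSchurMul, ← eq_intCast (Int.castRingHom R), ← MvPolynomial.coeff_map, map_mul, map_mul,
    map_delta]
  congr 3
  funext i
  simp

theorem card_of_lrCoeff_ne_zero {μ ν lam : YoungDiagram} (h : lrCoeff μ ν lam ≠ 0) :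
    lam.card = μ.card + ν.card := by
  rw [lrCoeff_eq_vcoeff le_rfl] at h
  exact card_of_vcoeff_deltaSchurMul_ne_zero le_rfl h

theorem lrCoeff_eq_zero_of_left {L : ℕ} {μ ν lam : YoungDiagram} (hlam : lam.colLen 0 ≤ L)
    (h : L < μ.colLen 0) : lrCoeff μ ν lam = 0 := by
  rw [lrCoeff_eq_vcoeff hlam, deltaSchurMul, schurPoly_eq_zero h, zero_mul, mul_zero, map_zero]

theorem lrCoeff_eq_zero_of_right {L : ℕ} {μ ν lam : YoungDiagram} (hlam : lam.colLen 0 ≤ L)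
    (h : L < ν.colLen 0) : lrCoeff μ ν lam = 0 := by
  rw [lrCoeff_eq_vcoeff hlam, deltaSchurMul, schurPoly_eq_zero h, mul_zero, mul_zero, map_zero]

theorem rowLen_zero_le_card (lam : YoungDiagram) : lam.rowLen 0 ≤ lam.card := by
  rw [YoungDiagram.rowLen_eq_card]
  exact Finset.card_le_card (Finset.filter_subset _ _)

/-- The product of the Cauchy expansions for `H` and `E` is the one for `H * E`; comparing
coefficients at `λ + ρ_L` gives the claim. The finite box holds all nonzero terms: lengths are
bounded by that of `λ`, the first part of `μ` by its size, and `s_{ν'}(y) = 0` once `ν` has a part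
above `m`. -/
theorem LS_eq_jt_of_schur_eq_jt {R : Type*} [CommRing R] [IsDomain R] {n m : ℕ} {z : Fin n → R}
    {y : Fin m → R} {H : PowerSeries R} {E : Polynomial R} (hE : E.natDegree ≤ m)
    (hz : ∀ (L : ℕ) (μ : YoungDiagram), μ.colLen 0 ≤ L → schur μ z = jt H (expo L μ))
    (hy : ∀ (L : ℕ) (ν : YoungDiagram), ν.colLen 0 ≤ L → ν.rowLen 0 ≤ m →
      schur ν.transpose y = jt (E : PowerSeries R) (expo L ν))
    {L : ℕ} {lam : YoungDiagram} (hlam : lam.colLen 0 ≤ L) :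
    LS lam z y = jt (H * (E : PowerSeries R)) (expo L lam) := by
  -- The Cauchy identity is stated for polynomials, so `H` is truncated; all exponents that occur
  -- are at most `|λ| + L`, so nothing is lost.
  set D := lam.card + L with hD
  set P : Polynomial R := PowerSeries.trunc (D + 1) H with hP
  have hPdeg : P.natDegree ≤ D := Nat.lt_succ_iff.1 (PowerSeries.natDegree_trunc_lt H D)
  have hPcoeff : ∀ k ≤ D, PowerSeries.coeff k (P : PowerSeries R) = PowerSeries.coeff k H := by
    intro k hk
    rw [Polynomial.coeff_coe, hP, PowerSeries.coeff_trunc, if_pos (by omega)]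
  have hexpo : ∀ μ : YoungDiagram, μ.card ≤ lam.card → ∀ i, expo L μ i ≤ D := by
    intro μ hμ i
    have h1 := rowLen_zero_le_card μ
    have h2 := μ.rowLen_anti 0 i (Nat.zero_le _)
    have h3 := i.2
    simp only [expo, Fin.val_rev]
    omega
  rw [LS, finsum_eq_sum_of_support_subset (s := box L D ×ˢ box L m)]
  · have hterm : ∀ p ∈ box L D ×ˢ box L m,
        (lrCoeff p.1 p.2 lam : R) * schur p.1 z * schur p.2.transpose y =
          vcoeff (expo L lam) (delta (MvPolynomial.X : Fin L → MvPolynomial (Fin L) R) *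
            ((jt (P : PowerSeries R) (expo L p.1) • schur p.1 MvPolynomial.X) *
              (jt (E : PowerSeries R) (expo L p.2) • schur p.2 MvPolynomial.X))) := by
      rintro ⟨μ, ν⟩ hp
      rw [Finset.mem_product, mem_box, mem_box] at hp
      simp only at hp ⊢
      rw [smul_mul_smul_comm, mul_smul_comm, map_smul, ← intCast_lrCoeff hlam, smul_eq_mul,
        hy L ν hp.2.1 hp.2.2, hz L μ hp.1.1]
      by_cases h0 : lrCoeff μ ν lam = 0
      · simp [h0]
      · have := card_of_lrCoeff_ne_zero h0
        rw [jt_congr hPcoeff (hexpo μ (by omega))]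
        ring
    rw [Finset.sum_congr rfl hterm, ← map_sum, ← Finset.mul_sum, Finset.sum_product]
    dsimp only
    rw [← Finset.sum_mul_sum, ← cauchy_identity L hPdeg, ← cauchy_identity L hE,
      ← Finset.prod_mul_distrib]
    simp_rw [← map_mul]
    rw [vcoeff_delta_mul_prod_aeval, Polynomial.coe_mul]
    refine jt_congr (N := D) (fun k hk => ?_) (hexpo lam le_rfl)
    rw [mul_comm, mul_comm H]
    exact coeff_mul_congr hPcoeff _ k hk
  · rintro ⟨μ, ν⟩ hp
    rw [Function.mem_support] at hp
    simp only at hp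
    have h0 : lrCoeff μ ν lam ≠ 0 := by
      intro h0
      rw [h0, Int.cast_zero, zero_mul, zero_mul] at hp
      exact hp rfl
    rw [Finset.mem_coe, Finset.mem_product, mem_box, mem_box]
    have hcard := card_of_lrCoeff_ne_zero h0
    have hr := rowLen_zero_le_card μ
    refine ⟨⟨?_, ?_⟩, ?_, ?_⟩ <;> simp only
    · by_contra hc
      exact h0 (lrCoeff_eq_zero_of_left hlam (by omega))
    · omega
    · by_contra hc
      exact h0 (lrCoeff_eq_zero_of_right hlam (by omega))
    · by_contra hc
      rw [schur_eq_zero (lam := ν.transpose) (by rw [YoungDiagram.colLen_transpose]; omega),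
        mul_zero] at hp
      exact hp rfl

/-! ### Generating series and partial fractions -/

/-- The geometric series `∑ z^k T^k`. -/
def geo {R : Type*} [CommRing R] (z : R) : PowerSeries R := PowerSeries.mk fun k => z ^ k

/-- The generating series `∏ (1 - z_i T)⁻¹` of the complete homogeneous symmetric functions. -/
def hgen {R : Type*} [CommRing R] {n : ℕ} (z : Fin n → R) : PowerSeries R := ∏ i, geo (z i)

/-- The generating polynomial `∏ (1 + y_j T)` of the elementary symmetric functions. -/
def egen {R : Type*} [CommRing R] {m : ℕ} (y : Fin m → R) : Polynomial R :=
  ∏ j, (1 + Polynomial.C (y j) * Polynomial.X)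

theorem one_sub_mul_geo {R : Type*} [CommRing R] (z : R) :
    (1 - PowerSeries.C z * PowerSeries.X) * geo z = 1 := by
  ext k
  rw [sub_mul, one_mul, mul_assoc, map_sub, PowerSeries.coeff_C_mul]
  cases k with
  | zero => simp [geo]
  | succ k =>
    rw [PowerSeries.coeff_succ_X_mul, PowerSeries.coeff_one, if_neg (Nat.succ_ne_zero k)]
    simp only [geo, PowerSeries.coeff_mk]
    ring

theorem natDegree_egen_le {R : Type*} [CommRing R] {m : ℕ} (y : Fin m → R) :
    (egen y).natDegree ≤ m := by
  refine (Polynomial.natDegree_prod_le _ _).trans ?_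
  refine (Finset.sum_le_sum (g := fun _ => 1) fun j _ => ?_).trans (by simp)
  compute_degree

theorem coe_egen {R : Type*} [CommRing R] {m : ℕ} (y : Fin m → R) :
    (egen y : PowerSeries R) = ∏ j, (1 + PowerSeries.C (y j) * PowerSeries.X) := by
  rw [egen, ← Polynomial.coeToPowerSeries.ringHom_apply, map_prod]
  simp

/-- The denominators `∏_{q ≠ p} (z_p - z_q)` of partial fractions. -/
def pfDen {R : Type*} [CommRing R] {n : ℕ} (z : Fin n → R) (p : Fin n) : R :=
  ∏ q ∈ Finset.univ.erase p, (z p - z q)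

/-- The sum is the coefficient of `X^(n-1)` in the Lagrange interpolation of `X^d` at the nodes `z`.
-/
theorem sum_pow_div_pfDen {F : Type*} [Field F] {n : ℕ} {z : Fin n → F}
    (hz : Function.Injective z) {d : ℕ} (hd : d < n) :
    ∑ p, z p ^ d / pfDen z p = if d + 1 = n then 1 else 0 := by
  have h := Lagrange.coeff_eq_sum (s := Finset.univ) (v := z) hz.injOn
    (P := (Polynomial.X : Polynomial F) ^ d) (by
      rw [Polynomial.degree_X_pow, Finset.card_univ, Fintype.card_fin]
      exact_mod_cast hd)
  rw [Polynomial.coeff_X_pow, Finset.card_univ, Fintype.card_fin] at h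
  simp only [Polynomial.eval_pow, Polynomial.eval_X] at h
  refine h.symm.trans (if_congr ?_ rfl rfl)
  omega

/-- Clearing denominators turns the partial fraction sum into a polynomial of degree below `n`, and
`sum_pow_div_pfDen` leaves only its coefficient at `T^(n-1)`, which is `1`. -/
theorem X_pow_mul_hgen {F : Type*} [Field F] {n : ℕ} (hn : n ≠ 0) {z : Fin n → F}
    (hz : Function.Injective z) :
    PowerSeries.X ^ n * hgen z =
      PowerSeries.X * ∑ p, PowerSeries.C (pfDen z p)⁻¹ * geo (z p) := by
  set G : PowerSeries F := ∑ p, PowerSeries.C (pfDen z p)⁻¹ * geo (z p) with hG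
  set D : PowerSeries F := ∏ p, (1 - PowerSeries.C (z p) * PowerSeries.X) with hD
  have hDH : D * hgen z = 1 := by
    rw [hD, hgen, ← Finset.prod_mul_distrib]
    exact Finset.prod_eq_one fun i _ => one_sub_mul_geo _
  have hGcoeff : ∀ d, PowerSeries.coeff d G = ∑ p, z p ^ d / pfDen z p := by
    intro d
    rw [hG, map_sum]
    refine Finset.sum_congr rfl fun p _ => ?_
    rw [PowerSeries.coeff_C_mul, geo, PowerSeries.coeff_mk, div_eq_inv_mul]
  have hhigh : ∀ r, n ≤ r → PowerSeries.coeff r (D * G) = 0 := by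
    intro r hr
    rw [hG, Finset.mul_sum, map_sum]
    refine Finset.sum_eq_zero fun p _ => ?_
    have h1 : D * (PowerSeries.C (pfDen z p)⁻¹ * geo (z p)) = PowerSeries.C (pfDen z p)⁻¹ *
        ((∏ q ∈ Finset.univ.erase p, (1 - Polynomial.C (z q) * Polynomial.X) : Polynomial F) :
          PowerSeries F) := by
      rw [hD, ← Finset.mul_prod_erase _ _ (Finset.mem_univ p),
        ← Polynomial.coeToPowerSeries.ringHom_apply, map_prod]
      simp only [map_sub, map_one, map_mul, Polynomial.coeToPowerSeries.ringHom_apply,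
        Polynomial.coe_C, Polynomial.coe_X]
      linear_combination PowerSeries.C (pfDen z p)⁻¹ * (∏ q ∈ Finset.univ.erase p,
        (1 - PowerSeries.C (z q) * PowerSeries.X)) * one_sub_mul_geo (z p)
    rw [h1, PowerSeries.coeff_C_mul, Polynomial.coeff_coe, Polynomial.coeff_eq_zero_of_natDegree_lt,
      mul_zero]
    have hp := p.2
    have h2 : (∏ q ∈ Finset.univ.erase p,
        (1 - Polynomial.C (z q) * Polynomial.X) : Polynomial F).natDegree ≤ n - 1 := by
      refine (Polynomial.natDegree_prod_le _ _).trans ?_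
      refine (Finset.sum_le_sum (g := fun _ => 1) fun j _ => ?_).trans
        (by simp [Finset.card_erase_of_mem])
      compute_degree
    omega
  have hDG : PowerSeries.X * (D * G) = PowerSeries.X ^ n := by
    ext r
    rw [PowerSeries.coeff_X_pow]
    cases r with
    | zero =>
      rw [PowerSeries.coeff_zero_X_mul, if_neg hn.symm]
    | succ r =>
      rw [PowerSeries.coeff_succ_X_mul]
      by_cases hr : n ≤ r
      · rw [hhigh r hr, if_neg (by omega)]
      · rw [PowerSeries.coeff_mul, Finset.sum_eq_single_of_mem (0, r) (by simp)]
        · rw [hGcoeff, sum_pow_div_pfDen hz (by omega)]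
          simp [hD, map_prod]
        · rintro ⟨a, b⟩ hab hne
          rw [Finset.HasAntidiagonal.mem_antidiagonal] at hab
          simp only at hab
          have ha : a ≠ 0 := by
            rintro rfl
            exact hne (by rw [zero_add] at hab; rw [hab])
          rw [hGcoeff, sum_pow_div_pfDen hz (by omega), if_neg (by omega), mul_zero]
  linear_combination PowerSeries.X * G * hDH - hgen z * hDG

/-- From index `m` on, every term of `∏ (1 + y_j T)` contributes to the convolution with the
geometric series, so the coefficient is formally `z^(e+m) E(1/z)`. -/
theorem coeff_geo_mul_egen {R : Type*} [CommRing R] (z : R) (e m : ℕ) (y : Fin m → R) :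
    PowerSeries.coeff (e + m) (geo z * (egen y : PowerSeries R)) = z ^ e * ∏ j, (z + y j) := by
  rw [coe_egen]
  induction m generalizing e with
  | zero => simp [geo]
  | succ m ih =>
    have h1 := ih e (y ∘ Fin.castSucc)
    have h2 := ih (e + 1) (y ∘ Fin.castSucc)
    rw [Fin.prod_univ_castSucc, Fin.prod_univ_castSucc, ← mul_assoc, mul_add, mul_one, map_add]
    set f := geo z * ∏ j : Fin m, (1 + PowerSeries.C (y j.castSucc) * PowerSeries.X) with hf
    have h3 : f * (PowerSeries.C (y (Fin.last m)) * PowerSeries.X) =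
        PowerSeries.C (y (Fin.last m)) * (PowerSeries.X * f) := by ring
    rw [h3, PowerSeries.coeff_C_mul, ← add_assoc, PowerSeries.coeff_succ_X_mul]
    simp only [Function.comp_apply] at h1 h2
    rw [show e + 1 + m = e + m + 1 by omega] at h2
    rw [h1, h2]
    ring

/-- The weights `∏_j (z_p + y_j) / ∏_{q ≠ p} (z_p - z_q)`. -/
def pfWeight {F : Type*} [Field F] {n m : ℕ} (z : Fin n → F) (y : Fin m → F) (p : Fin n) : F :=
  (∏ j, (z p + y j)) / pfDen z p

theorem coeff_X_pow_mul_hgen_mul_egen {F : Type*} [Field F] {n m : ℕ} {z : Fin n → F}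
    (hz : Function.Injective z) (y : Fin m → F) {a c e : ℕ} (h : a + n = c + m + 1 + e) :
    PowerSeries.coeff a (PowerSeries.X ^ c * (hgen z * (egen y : PowerSeries F))) =
      ∑ p, pfWeight z y p * z p ^ e := by
  have h1 : PowerSeries.coeff a (PowerSeries.X ^ c * (hgen z * (egen y : PowerSeries F))) =
      PowerSeries.coeff (e + m + 1) (PowerSeries.X ^ n * (hgen z * (egen y : PowerSeries F))) := by
    rw [← PowerSeries.coeff_X_pow_mul _ n a, ← PowerSeries.coeff_X_pow_mul _ c (e + m + 1),
      show a + n = e + m + 1 + c by omega]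
    congr 1
    ring
  rw [h1]
  -- Without variables there is no partial fraction expansion; the coefficient vanishes because its
  -- index exceeds the degree of `egen y`.
  rcases eq_or_ne n 0 with rfl | hn
  · rw [hgen, Finset.univ_eq_empty, Finset.prod_empty, one_mul, pow_zero, one_mul,
      Finset.sum_empty, Polynomial.coeff_coe]
    refine Polynomial.coeff_eq_zero_of_natDegree_lt ?_
    have := natDegree_egen_le y
    omega
  · rw [← mul_assoc, X_pow_mul_hgen hn hz, mul_assoc, PowerSeries.coeff_succ_X_mul,
      Finset.sum_mul, map_sum]
    refine Finset.sum_congr rfl fun p _ => ?_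
    rw [mul_assoc, PowerSeries.coeff_C_mul, coeff_geo_mul_egen, pfWeight]
    ring

/-! ### Expansion of determinants along a block of rows -/

/-- An injective map is uniquely the increasing enumeration of its image composed with a
permutation. -/
theorem sum_functions_eq_sum_subsets {R : Type*} [AddCommMonoid R] {l n : ℕ}
    (f : (Fin l → Fin n) → R) (hf : ∀ g, ¬ Function.Injective g → f g = 0) :
    ∑ g, f g = ∑ S ∈ (Finset.powersetCard l (Finset.univ : Finset (Fin n))).attach,
      ∑ σ : Equiv.Perm (Fin l),
        f (S.1.orderEmbOfFin (Finset.mem_powersetCard.1 S.2).2 ∘ σ) := by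
  classical
  rw [← Finset.sum_filter_of_ne (p := Function.Injective) (fun g _ h => by
    by_contra hc
    exact h (hf g hc)), Finset.sum_sigma']
  symm
  refine Finset.sum_bij (fun x _ => x.1.1.orderEmbOfFin (Finset.mem_powersetCard.1 x.1.2).2 ∘ x.2)
    ?_ ?_ ?_ ?_
  · intro x _
    rw [Finset.mem_filter]
    exact ⟨Finset.mem_univ _, (RelEmbedding.injective _).comp x.2.injective⟩
  · rintro ⟨⟨S, hS⟩, σ⟩ _ ⟨⟨T, hT⟩, τ⟩ _ h
    simp only at h
    have hr := congrArg Set.range h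
    rw [σ.surjective.range_comp, τ.surjective.range_comp, Finset.range_orderEmbOfFin,
      Finset.range_orderEmbOfFin, Finset.coe_inj] at hr
    subst hr
    have : σ = τ := by
      ext1 i
      exact (RelEmbedding.injective _) (congrFun h i)
    rw [this]
  · intro g hg
    rw [Finset.mem_filter] at hg
    have hS : Finset.univ.image g ∈ Finset.powersetCard l (Finset.univ : Finset (Fin n)) := by
      rw [Finset.mem_powersetCard, Finset.card_image_of_injective _ hg.2]
      simp
    set emb := (Finset.univ.image g).orderEmbOfFin (Finset.mem_powersetCard.1 hS).2 with hemb
    have hex : ∀ i, ∃ k, emb k = g i := by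
      intro i
      have : g i ∈ Set.range emb := by
        rw [hemb, Finset.range_orderEmbOfFin]
        simp
      exact this
    choose s hs using hex
    have hsinj : Function.Injective s := by
      intro i j hij
      apply hg.2
      rw [← hs i, ← hs j, hij]
    refine ⟨⟨⟨_, hS⟩, Equiv.ofBijective s (Finite.injective_iff_bijective.1 hsinj)⟩, by simp, ?_⟩
    funext i
    exact hs i
  · intro x _
    rfl

/-- A Cauchy-Binet expansion in one block of rows: multilinearity gives a sum over maps, a repeated
value gives equal rows, and the permutations belonging to one image sum to a minor of `B`. -/
theorem det_sum_rows {R κ : Type*} [CommRing R] [Fintype κ] [DecidableEq κ] {l n : ℕ}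
    (B : Matrix (Fin l) (Fin n) R) (V : Fin n → Fin l ⊕ κ → R) (C : κ → Fin l ⊕ κ → R) :
    (Matrix.of (Sum.elim (fun i => ∑ p, B i p • V p) C)).det =
      ∑ S ∈ (Finset.powersetCard l (Finset.univ : Finset (Fin n))).attach,
        (B.submatrix id (S.1.orderEmbOfFin (Finset.mem_powersetCard.1 S.2).2)).det *
          (Matrix.of (Sum.elim
            (fun i => V (S.1.orderEmbOfFin (Finset.mem_powersetCard.1 S.2).2 i)) C)).det := by
  have h1 : (Matrix.of (Sum.elim (fun i => ∑ p, B i p • V p) C)).det =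
      ∑ g : Fin l → Fin n, (∏ i, B i (g i)) * (Matrix.of (Sum.elim (fun i => V (g i)) C)).det := by
    let D := (Matrix.detRowAlternating (n := Fin l ⊕ κ) (R := R)).toMultilinearMap.currySum
    have hD : ∀ u, D u C = (Matrix.of (Sum.elim u C)).det := by
      intro u
      change (Matrix.detRowAlternating (n := Fin l ⊕ κ) (R := R)) _ = _
      refine congrArg (Matrix.detRowAlternating (n := Fin l ⊕ κ) (R := R)) ?_
      funext i
      cases i <;> rfl
    rw [← hD, MultilinearMap.map_sum, sum_apply]
    refine Finset.sum_congr rfl fun g _ => ?_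
    rw [MultilinearMap.map_smul_univ, smul_apply, hD, smul_eq_mul]
  rw [h1, sum_functions_eq_sum_subsets]
  · refine Finset.sum_congr rfl fun S _ => ?_
    set emb := S.1.orderEmbOfFin (Finset.mem_powersetCard.1 S.2).2
    rw [← Matrix.det_transpose (B.submatrix id emb), Matrix.det_apply', Finset.sum_mul]
    refine Finset.sum_congr rfl fun σ _ => ?_
    have h2 := Matrix.det_permute (Equiv.sumCongr σ (1 : Equiv.Perm κ))
      (Matrix.of (Sum.elim (fun i => V (emb i)) C))
    have h3 : Matrix.submatrix (Matrix.of (Sum.elim (fun i => V (emb i)) C))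
        (Equiv.sumCongr σ (1 : Equiv.Perm κ)) id =
        Matrix.of (Sum.elim (fun i => V ((emb ∘ σ) i)) C) := by
      ext i j
      cases i <;> rfl
    rw [h3, Equiv.Perm.sign_sumCongr, Equiv.Perm.sign_one, mul_one] at h2
    rw [h2]
    simp only [Function.comp_apply, Matrix.transpose_apply, Matrix.submatrix_apply, id]
    ring
  · intro g hg
    simp only [Function.Injective, not_forall] at hg
    obtain ⟨i, j, hij, hne⟩ := hg
    rw [Matrix.det_zero_of_row_eq (i := Sum.inl i) (j := Sum.inl j) (by simpa using hne), mul_zero]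
    change V (g i) = V (g j)
    rw [hij]

/-! ### Elimination of evaluation rows -/

theorem reflect_eq_sum {R : Type*} [CommRing R] {N : ℕ} {P : Polynomial R} (hP : P.natDegree < N) :
    P.reflect (N - 1) =
      ∑ k : Fin N, Polynomial.C (P.coeff k) * Polynomial.X ^ (k.rev : ℕ) := by
  have h := P.as_sum_range' N hP
  have h2 := congrArg (AddMonoidHom.mk' (Polynomial.reflect (R := R) (N - 1))
    fun f g => Polynomial.reflect_add f g _) h
  rw [map_sum, Finset.sum_range] at h2
  refine h2.trans (Finset.sum_congr rfl fun k _ => ?_)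
  have hk := k.2
  rw [AddMonoidHom.mk'_apply, ← Polynomial.C_mul_X_pow_eq_monomial,
    Polynomial.reflect_C_mul_X_pow, Polynomial.revAt_le (by omega), Fin.val_rev]
  congr 2
  omega

/-- Columns carry the powers of `T` in decreasing order, so combining them with the coefficients of
`P` multiplies the series by the reversed polynomial. -/
theorem sum_coeff_X_pow_mul {R : Type*} [CommRing R] {N : ℕ} {P : Polynomial R}
    (hP : P.natDegree < N) (f : PowerSeries R) (b : ℕ) :
    ∑ k : Fin N, PowerSeries.coeff b (PowerSeries.X ^ (k.rev : ℕ) * f) * P.coeff k =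
      PowerSeries.coeff b ((P.reflect (N - 1) : PowerSeries R) * f) := by
  rw [reflect_eq_sum hP, ← Polynomial.coeToPowerSeries.ringHom_apply, map_sum, Finset.sum_mul,
    map_sum]
  refine Finset.sum_congr rfl fun k _ => ?_
  rw [Polynomial.coeToPowerSeries.ringHom_apply, Polynomial.coe_mul, Polynomial.coe_pow,
    Polynomial.coe_C, Polynomial.coe_X, mul_assoc, PowerSeries.coeff_C_mul, mul_comm]

theorem reflect_nodal {R : Type*} [CommRing R] [Nontrivial R] {l : ℕ} (u : Fin l → R) :
    (Lagrange.nodal Finset.univ u).reflect l =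
      ∏ i, (1 - Polynomial.C (u i) * Polynomial.X) := by
  rw [Lagrange.nodal_eq]
  induction l with
  | zero => simp
  | succ l ih =>
    rw [Fin.prod_univ_castSucc, Fin.prod_univ_castSucc, Polynomial.reflect_mul]
    · have h1 := ih (u ∘ Fin.castSucc)
      simp only [Function.comp_apply] at h1
      rw [h1]
      congr 1
      simp
    · have := Lagrange.natDegree_nodal (s := Finset.univ) (v := u ∘ Fin.castSucc)
      rw [Lagrange.nodal_eq] at this
      simp only [Function.comp_apply] at this
      rw [this]
      simp
    · exact (Polynomial.natDegree_X_sub_C _).le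

/-- A unitriangular column operation replaces the last `r` columns by multiples of `∏ (X - u_s)`.
The evaluation rows vanish there, while the other rows acquire the reversed factor `∏ (1 - u_s T)`,
so the determinant becomes block triangular. -/
theorem det_eval_rows {R : Type*} [CommRing R] [Nontrivial R] {l r : ℕ} (u : Fin l → R)
    (f : PowerSeries R) (β : Fin r → ℕ) :
    (Matrix.of (Sum.elim (fun i (j : Fin l ⊕ Fin r) => u i ^ (finSumFinEquiv j : ℕ))
      (fun i (j : Fin l ⊕ Fin r) => PowerSeries.coeff (β i)
        (PowerSeries.X ^ ((finSumFinEquiv j).rev : ℕ) * f)))).det =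
      (Matrix.vandermonde u).det *
        jt ((∏ s, (1 - PowerSeries.C (u s) * PowerSeries.X)) * f) β := by
  set M := Matrix.of (Sum.elim (fun i (j : Fin l ⊕ Fin r) => u i ^ (finSumFinEquiv j : ℕ))
      (fun i (j : Fin l ⊕ Fin r) => PowerSeries.coeff (β i)
        (PowerSeries.X ^ ((finSumFinEquiv j).rev : ℕ) * f))) with hM
  let nod : Polynomial R := Lagrange.nodal Finset.univ u
  have hnod : nod.natDegree = l := by simp [nod]
  have hmon : nod.Monic := Lagrange.nodal_monic
  -- The new column basis: `q j` is monic of degree `j`, so the change of basis has determinant `1`,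
  -- and the last `r` members vanish at every `u s`.
  let q : Fin (l + r) → Polynomial R := Fin.addCases (fun j => Polynomial.X ^ (j : ℕ))
    (fun j => Polynomial.X ^ (j : ℕ) * nod)
  have hql : ∀ j : Fin l, q (Fin.castAdd r j) = Polynomial.X ^ (j : ℕ) := fun j => by simp [q]
  have hqr : ∀ j : Fin r, q (Fin.natAdd l j) = Polynomial.X ^ (j : ℕ) * nod := fun j => by simp [q]
  have hdeg : ∀ j, (q j).natDegree = j := by
    intro j
    refine Fin.addCases (fun j => ?_) (fun j => ?_) j
    · rw [hql, Polynomial.natDegree_X_pow, Fin.val_castAdd]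
    · rw [hqr, (Polynomial.monic_X_pow _).natDegree_mul hmon, Polynomial.natDegree_X_pow, hnod,
        Fin.val_natAdd, add_comm]
  have hmonic : ∀ j, (q j).Monic := by
    intro j
    refine Fin.addCases (fun j => ?_) (fun j => ?_) j
    · rw [hql]; exact Polynomial.monic_X_pow _
    · rw [hqr]; exact (Polynomial.monic_X_pow _).mul hmon
  let U := (Matrix.of fun i j : Fin (l + r) => (q j).coeff i).submatrix
    (finSumFinEquiv (m := l) (n := r)) (finSumFinEquiv (m := l) (n := r))
  have hU : U.det = 1 := by
    rw [Matrix.det_submatrix_equiv_self, Matrix.det_matrixOfPolynomials q hdeg hmonic]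
  have hrow1 : ∀ (i : Fin l) (j : Fin l ⊕ Fin r),
      (M * U) (Sum.inl i) j = (q (finSumFinEquiv j)).eval (u i) := by
    intro i j
    rw [Matrix.mul_apply]
    refine (Equiv.sum_comp finSumFinEquiv (fun k : Fin (l + r) =>
      u i ^ (k : ℕ) * (q (finSumFinEquiv j)).coeff k)).trans ?_
    rw [Polynomial.eval_eq_sum_range' (n := l + r) (by rw [hdeg]; exact (finSumFinEquiv j).2),
      Finset.sum_range]
    exact Finset.sum_congr rfl fun k _ => mul_comm _ _
  have hrow2 : ∀ (i : Fin r) (j : Fin l ⊕ Fin r), (M * U) (Sum.inr i) j =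
      PowerSeries.coeff (β i)
        (((q (finSumFinEquiv j)).reflect (l + r - 1) : PowerSeries R) * f) := by
    intro i j
    rw [Matrix.mul_apply]
    refine (Equiv.sum_comp finSumFinEquiv (fun k : Fin (l + r) =>
      PowerSeries.coeff (β i) (PowerSeries.X ^ (k.rev : ℕ) * f) *
        (q (finSumFinEquiv j)).coeff k)).trans ?_
    exact sum_coeff_X_pow_mul (by rw [hdeg]; exact (finSumFinEquiv j).2) f (β i)
  have hblock : M * U = Matrix.fromBlocks (Matrix.vandermonde u) 0
      (Matrix.of fun i j => (M * U) (Sum.inr i) (Sum.inl j))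
      (Matrix.of fun i j : Fin r => PowerSeries.coeff (β i) (PowerSeries.X ^ (j.rev : ℕ) *
        ((∏ s, (1 - PowerSeries.C (u s) * PowerSeries.X)) * f))) := by
    ext i j
    rcases i with i | i <;> rcases j with j | j
    · rw [hrow1, finSumFinEquiv_apply_left, hql]
      simp [Matrix.vandermonde_apply]
    · rw [hrow1, finSumFinEquiv_apply_right, hqr, Polynomial.eval_mul,
        Lagrange.eval_nodal_at_node (Finset.mem_univ i), mul_zero]
      rfl
    · rfl
    · have hj := j.2
      rw [hrow2, finSumFinEquiv_apply_right, hqr, show l + r - 1 = (r - 1) + l by omega,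
        Polynomial.reflect_mul _ _ (by rw [Polynomial.natDegree_X_pow]; omega) hnod.le,
        reflect_nodal, Polynomial.reflect_monomial, Polynomial.revAt_le (by omega),
        Matrix.fromBlocks_apply₂₂, Matrix.of_apply, Polynomial.coe_mul, Polynomial.coe_pow,
        Polynomial.coe_X, ← Polynomial.coeToPowerSeries.ringHom_apply, map_prod, mul_assoc,
        Fin.val_rev, show r - (j + 1) = r - 1 - (j : ℕ) by omega]
      simp
  rw [← mul_one M.det, ← hU, ← Matrix.det_mul, hblock, Matrix.det_fromBlocks_zero₁₂, jt]

theorem jt_append_eq_det {R : Type*} [CommRing R] (f : PowerSeries R) {l r : ℕ} (α : Fin l → ℕ)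
    (β : Fin r → ℕ) :
    jt f (Fin.append α β) = (Matrix.of (Sum.elim
      (fun i (j : Fin l ⊕ Fin r) => PowerSeries.coeff (α i)
        (PowerSeries.X ^ ((finSumFinEquiv j).rev : ℕ) * f))
      (fun i (j : Fin l ⊕ Fin r) => PowerSeries.coeff (β i)
        (PowerSeries.X ^ ((finSumFinEquiv j).rev : ℕ) * f)))).det := by
  rw [jt, ← Matrix.det_submatrix_equiv_self (finSumFinEquiv (m := l) (n := r))]
  congr 1
  ext i j
  rcases i with i | i <;> simp

/-- The hypothesis `h` says that the rows of `α` lie in the range where partial fractions are valid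
in every column: column `j` contributes the exponent `γ i + j`. -/
theorem jt_expand {F : Type*} [Field F] {n m l r : ℕ} {z : Fin n → F}
    (hz : Function.Injective z) (y : Fin m → F) {α γ : Fin l → ℕ} (β : Fin r → ℕ)
    (h : ∀ i, α i + n = m + (l + r) + γ i) :
    jt (hgen z * (egen y : PowerSeries F)) (Fin.append α β) =
      ∑ S ∈ (Finset.powersetCard l (Finset.univ : Finset (Fin n))).attach,
        (Matrix.of fun i j : Fin l =>
          pfWeight z y (S.1.orderEmbOfFin (Finset.mem_powersetCard.1 S.2).2 j) *
            z (S.1.orderEmbOfFin (Finset.mem_powersetCard.1 S.2).2 j) ^ γ i).det *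
        ((Matrix.vandermonde (z ∘ S.1.orderEmbOfFin (Finset.mem_powersetCard.1 S.2).2)).det *
          jt ((∏ s, (1 - PowerSeries.C (z (S.1.orderEmbOfFin (Finset.mem_powersetCard.1 S.2).2 s)) *
            PowerSeries.X)) * (hgen z * (egen y : PowerSeries F))) β) := by
  have h1 : ∀ (i : Fin l), (fun j : Fin l ⊕ Fin r => PowerSeries.coeff (α i)
      (PowerSeries.X ^ ((finSumFinEquiv j).rev : ℕ) * (hgen z * (egen y : PowerSeries F)))) =
      ∑ p, (Matrix.of fun (i : Fin l) p => pfWeight z y p * z p ^ γ i) i p •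
        (fun j : Fin l ⊕ Fin r => z p ^ (finSumFinEquiv j : ℕ)) := by
    intro i
    funext j
    have hj := (finSumFinEquiv j).2
    rw [coeff_X_pow_mul_hgen_mul_egen hz y (e := γ i + finSumFinEquiv j) (by
      have := h i
      rw [Fin.val_rev]
      omega), Finset.sum_apply]
    refine Finset.sum_congr rfl fun p _ => ?_
    rw [Pi.smul_apply, Matrix.of_apply, smul_eq_mul, pow_add, mul_assoc]
  rw [jt_append_eq_det]
  rw [funext h1, det_sum_rows]
  refine Finset.sum_congr rfl fun S _ => ?_
  rw [det_eval_rows (fun i => z (S.1.orderEmbOfFin (Finset.mem_powersetCard.1 S.2).2 i))]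
  rfl

/-! ### The Jacobi-Trudi formula -/

/-- The additional row has exponent `0`, hence equals `(0, …, 0, 1)`. -/
theorem jt_expo_succ {R : Type*} [CommRing R] {f : PowerSeries R}
    (hf : PowerSeries.coeff 0 f = 1) {L : ℕ} {lam : YoungDiagram} (h : lam.colLen 0 ≤ L) :
    jt f (expo (L + 1) lam) = jt f (expo L lam) := by
  have hlast : expo (L + 1) lam (Fin.last L) = 0 := by
    simp [expo, colLen_le_iff.1 h L le_rfl]
  rw [jt, Matrix.det_succ_row _ (Fin.last L), Fin.sum_univ_castSucc, Finset.sum_eq_zero, zero_add]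
  · have h2 : (-1 : R) ^ ((Fin.last L : ℕ) + (Fin.last L : ℕ)) = 1 := Even.neg_one_pow ⟨_, rfl⟩
    rw [h2, Matrix.of_apply, hlast, Fin.rev_last, Fin.val_zero, pow_zero, one_mul, one_mul, hf,
      one_mul, jt]
    congr 1
    refine Matrix.ext fun i j => ?_
    have hi := i.2
    have hj := j.2
    rw [Matrix.submatrix_apply, Fin.succAbove_last, Matrix.of_apply, Matrix.of_apply,
      show expo (L + 1) lam i.castSucc = expo L lam i + 1 by
        simp only [expo, Fin.val_rev, Fin.val_castSucc]; omega,
      show (j.castSucc.rev : ℕ) = j.rev + 1 by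
        simp only [Fin.val_rev, Fin.val_castSucc]; omega,
      pow_succ', mul_assoc, PowerSeries.coeff_succ_X_mul]
  · intro j _
    have hj := j.2
    rw [Matrix.of_apply, hlast, show (j.castSucc.rev : ℕ) = j.rev + 1 by
        simp only [Fin.val_rev, Fin.val_castSucc]; omega, pow_succ',
      mul_assoc PowerSeries.X, PowerSeries.coeff_zero_X_mul, mul_zero, zero_mul]

theorem jt_expo_eq {R : Type*} [CommRing R] {f : PowerSeries R}
    (hf : PowerSeries.coeff 0 f = 1) {L : ℕ} {lam : YoungDiagram} (h : lam.colLen 0 ≤ L) :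
    jt f (expo L lam) = jt f (expo (lam.colLen 0) lam) := by
  induction L, h using Nat.le_induction with
  | base => rfl
  | succ L hL ih => rw [jt_expo_succ hf hL, ih]

theorem colLen_bot (j : ℕ) : (⊥ : YoungDiagram).colLen j = 0 := by
  by_contra hc
  exact YoungDiagram.notMem_bot (0, j) (YoungDiagram.mem_iff_lt_colLen.2 (Nat.pos_of_ne_zero hc))

theorem rowLen_bot (i : ℕ) : (⊥ : YoungDiagram).rowLen i = 0 := by
  by_contra hc
  exact YoungDiagram.notMem_bot (i, 0) (YoungDiagram.mem_iff_lt_rowLen.2 (Nat.pos_of_ne_zero hc))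

theorem expo_bot (L : ℕ) : expo L ⊥ = fun i => (i.rev : ℕ) := by
  funext i
  rw [expo, rowLen_bot, zero_add]

theorem jt_expo_bot {R : Type*} [CommRing R] {f : PowerSeries R}
    (hf : PowerSeries.coeff 0 f = 1) (L : ℕ) : jt f (expo L ⊥) = 1 := by
  rw [jt_expo_eq hf (by rw [colLen_bot]; exact Nat.zero_le _), colLen_bot, jt]
  exact Matrix.det_isEmpty

theorem coeff_zero_hgen {R : Type*} [CommRing R] {n : ℕ} (z : Fin n → R) :
    PowerSeries.coeff 0 (hgen z) = 1 := by
  rw [PowerSeries.coeff_zero_eq_constantCoeff_apply, hgen, map_prod]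
  refine Finset.prod_eq_one fun i _ => ?_
  rw [← PowerSeries.coeff_zero_eq_constantCoeff_apply, geo, PowerSeries.coeff_mk, pow_zero]

theorem coeff_zero_egen {R : Type*} [CommRing R] {m : ℕ} (y : Fin m → R) :
    PowerSeries.coeff 0 (egen y : PowerSeries R) = 1 := by
  rw [PowerSeries.coeff_zero_eq_constantCoeff_apply, coe_egen, map_prod]
  simp

theorem append_expo (l r : ℕ) (lam : YoungDiagram) :
    Fin.append (fun i => expo (l + r) lam (Fin.castAdd r i))
      (fun j => expo (l + r) lam (Fin.natAdd l j)) = expo (l + r) lam :=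
  Fin.append_castAdd_natAdd

/-- When all `n` rows are expanded, the whole index set is the only subset and the remaining
determinant is empty. -/
theorem jt_hgen_mul_egen_of_full {F : Type*} [Field F] {n m : ℕ} {z : Fin n → F}
    (hz : Function.Injective z) (y : Fin m → F) {α γ : Fin n → ℕ} (hα : ∀ i, α i = m + γ i) :
    jt (hgen z * (egen y : PowerSeries F)) α =
      (Matrix.of fun i j : Fin n => pfWeight z y j * z j ^ γ i).det *
        (Matrix.vandermonde z).det := by
  have h := jt_expand (l := n) (r := 0) hz y (α := fun i : Fin n => α (Fin.castAdd 0 i)) (γ := γ)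
    (fun j : Fin 0 => α (Fin.natAdd n j)) (fun i => by
      change α i + n = _
      rw [hα]
      omega)
  rw [show Fin.append (fun i : Fin n => α (Fin.castAdd 0 i)) (fun j : Fin 0 => α (Fin.natAdd n j)) =
    α from Fin.append_castAdd_natAdd (n := 0)] at h
  refine h.trans ?_
  have hps : Finset.powersetCard n (Finset.univ : Finset (Fin n)) = {Finset.univ} := by
    have := Finset.powersetCard_self (Finset.univ : Finset (Fin n))
    rwa [Finset.card_univ, Fintype.card_fin] at this
  have hmem : Finset.univ ∈ Finset.powersetCard n (Finset.univ : Finset (Fin n)) := by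
    rw [hps]; exact Finset.mem_singleton_self _
  rw [Finset.sum_eq_single_of_mem ⟨Finset.univ, hmem⟩ (Finset.mem_attach _ _)]
  · have hid : ((Finset.univ : Finset (Fin n)).orderEmbOfFin (Finset.mem_powersetCard.1 hmem).2 :
        Fin n → Fin n) = id :=
      (Finset.orderEmbOfFin_unique _ (fun _ => Finset.mem_univ _) strictMono_id).symm
    simp only [hid, id, Function.comp_id]
    rw [show jt _ _ = (1 : F) from Matrix.det_isEmpty, mul_one]
  · rintro ⟨S, hS⟩ _ hne
    refine absurd ?_ hne
    have := hS
    rw [hps, Finset.mem_singleton] at this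
    subst this
    rfl

theorem jt_hgen_expo {F : Type*} [Field F] {n : ℕ} {z : Fin n → F} (hz : Function.Injective z)
    (μ : YoungDiagram) :
    jt (hgen z) (expo n μ) = (∏ p, pfWeight z (Fin.elim0 : Fin 0 → F) p) *
      (Matrix.of fun a b : Fin n => z a ^ expo n μ b).det * (Matrix.vandermonde z).det := by
  have h := jt_hgen_mul_egen_of_full hz (Fin.elim0 : Fin 0 → F) (α := expo n μ) (γ := expo n μ)
    (fun i => (zero_add _).symm)
  rw [show egen (Fin.elim0 : Fin 0 → F) = 1 by simp [egen], Polynomial.coe_one, mul_one] at h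
  rw [h, Matrix.det_mul_row (fun j => pfWeight z Fin.elim0 j) (fun i j => z j ^ expo n μ i),
    ← Matrix.det_transpose (Matrix.of fun a b : Fin n => z a ^ expo n μ b)]
  rfl

/-- For length at most `n` the determinant is the alternant of `z` times a factor independent of
`μ`; the empty partition, whose determinant is `1`, shows that this factor is `1/Δ(z)`. -/
theorem schur_eq_jt_hgen {F : Type*} [Field F] {n : ℕ} {z : Fin n → F}
    (hz : Function.Injective z) (L : ℕ) (μ : YoungDiagram) (hL : μ.colLen 0 ≤ L) :
    schur μ z = jt (hgen z) (expo L μ) := by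
  rw [jt_expo_eq (coeff_zero_hgen z) hL]
  by_cases hn : μ.colLen 0 ≤ n
  · rw [← jt_expo_eq (coeff_zero_hgen z) hn, jt_hgen_expo hz, ← delta_mul_schur hn]
    have h := jt_hgen_expo hz ⊥
    rw [jt_expo_bot (coeff_zero_hgen z), expo_bot, ← delta_eq_det] at h
    linear_combination schur μ z * h
  · rw [schur_eq_zero (not_le.1 hn)]
    -- Here `n + 1` rows belong to positive parts, which suffices for partial fractions to apply;
    -- the expansion then runs over `(n+1)`-subsets of an `n`-set, so it is empty.
    obtain ⟨r, hr⟩ := Nat.exists_eq_add_of_le (show n + 1 ≤ μ.colLen 0 by omega)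
    have h := jt_expand (l := n + 1) (r := r) hz (Fin.elim0 : Fin 0 → F)
      (α := fun i => expo (n + 1 + r) μ (Fin.castAdd r i))
      (γ := fun i => μ.rowLen i + n - 1 - i)
      (fun j => expo (n + 1 + r) μ (Fin.natAdd (n + 1) j)) (fun i => by
        have hi := i.2
        have : ((i : ℕ), 0) ∈ μ := YoungDiagram.mem_iff_lt_colLen.2 (by omega)
        have := YoungDiagram.mem_iff_lt_rowLen.1 this
        simp only [expo, Fin.val_rev, Fin.val_castAdd]
        omega)
    rw [append_expo, show egen (Fin.elim0 : Fin 0 → F) = 1 by simp [egen], Polynomial.coe_one,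
      mul_one] at h
    rw [hr, h]
    symm
    refine Finset.sum_eq_zero ?_
    rintro ⟨S, hS⟩ _
    have h1 := (Finset.mem_powersetCard.1 hS).2
    have h2 := S.card_le_univ
    rw [Fintype.card_fin] at h2
    omega

/-! ### The dual Jacobi-Trudi formula -/

/-- The exponents `L + j - ν'_j`, complementary to `ν + ρ_L`. -/
def coexpo (L m : ℕ) (ν : YoungDiagram) : Fin m → ℕ := fun j => L + j - ν.colLen j

theorem colLen_le {ν : YoungDiagram} {L : ℕ} (h : ν.colLen 0 ≤ L) (j : ℕ) : ν.colLen j ≤ L :=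
  (ν.colLen_anti 0 j (Nat.zero_le _)).trans h

theorem expo_lt_coexpo_iff {L m : ℕ} {ν : YoungDiagram} (h : ν.colLen 0 ≤ L) (i : Fin L)
    (j : Fin m) : expo L ν i < coexpo L m ν j ↔ ¬ (i : ℕ) < ν.colLen j := by
  have h1 : (i : ℕ) < ν.colLen j ↔ (j : ℕ) < ν.rowLen i := by
    rw [← YoungDiagram.mem_iff_lt_colLen, YoungDiagram.mem_iff_lt_rowLen]
  have h2 := colLen_le h j
  have h3 := i.2
  simp only [expo, coexpo, Fin.val_rev]
  omega

theorem expo_ne_coexpo {L m : ℕ} {ν : YoungDiagram} (h : ν.colLen 0 ≤ L) (i : Fin L)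
    (j : Fin m) : expo L ν i ≠ coexpo L m ν j := by
  have h1 : (i : ℕ) < ν.colLen j ↔ (j : ℕ) < ν.rowLen i := by
    rw [← YoungDiagram.mem_iff_lt_colLen, YoungDiagram.mem_iff_lt_rowLen]
  have h2 := colLen_le h j
  have h3 := i.2
  simp only [expo, coexpo, Fin.val_rev]
  omega

theorem coexpo_strictMono {L m : ℕ} {ν : YoungDiagram} (h : ν.colLen 0 ≤ L) :
    StrictMono (coexpo L m ν) := by
  intro i j hij
  have h1 : (i : ℕ) < j := hij
  have h2 := ν.colLen_anti i j h1.le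
  have h3 := colLen_le h i
  simp only [coexpo]
  omega

/-- The exponents `ν + ρ_L` and their complement enumerate `0, …, L + m - 1`. -/
theorem exists_exponent_equiv {L m : ℕ} {ν : YoungDiagram} (h : ν.colLen 0 ≤ L)
    (h' : ν.rowLen 0 ≤ m) : ∃ τ : Fin L ⊕ Fin m ≃ Fin (L + m),
      (∀ i, (τ (Sum.inl i) : ℕ) = expo L ν i) ∧ ∀ j, (τ (Sum.inr j) : ℕ) = coexpo L m ν j := by
  have hlt : ∀ x : Fin L ⊕ Fin m, Sum.elim (expo L ν) (coexpo L m ν) x < L + m := by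
    rintro (i | j)
    · have h1 := ν.rowLen_anti 0 i (Nat.zero_le _)
      have h2 := i.2
      simp only [Sum.elim_inl, expo, Fin.val_rev]
      omega
    · have h2 := j.2
      simp only [Sum.elim_inr, coexpo]
      omega
  let t : Fin L ⊕ Fin m → Fin (L + m) := fun x => ⟨_, hlt x⟩
  have ht : Function.Injective t := by
    intro x x' hx
    have hx' : Sum.elim (expo L ν) (coexpo L m ν) x = Sum.elim (expo L ν) (coexpo L m ν) x' :=
      congrArg Fin.val hx
    rcases x with i | j <;> rcases x' with i' | j' <;> simp only [Sum.elim_inl, Sum.elim_inr] at hx'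
    · rw [(expo_strictAnti L ν).injective hx']
    · exact absurd hx' (expo_ne_coexpo h _ _)
    · exact absurd hx'.symm (expo_ne_coexpo h _ _)
    · rw [(coexpo_strictMono h).injective hx']
  have hb : Function.Bijective t :=
    (Fintype.bijective_iff_injective_and_card t).2 ⟨ht, by simp⟩
  exact ⟨Equiv.ofBijective t hb, fun i => rfl, fun j => rfl⟩

theorem prod_ite_lt_neg_one (L c : ℕ) (h : c ≤ L) :
    ∏ i : Fin L, (if (i : ℕ) < c then -1 else 1 : ℤˣ) = (-1) ^ c := by
  rw [Fin.prod_univ_eq_prod_range (fun i => (if i < c then -1 else 1 : ℤˣ)), Finset.prod_ite,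
    Finset.prod_const, Finset.prod_const_one, mul_one]
  congr 1
  rw [show (Finset.range L).filter (fun i => i < c) = Finset.range c by
    ext i; simp only [Finset.mem_filter, Finset.mem_range]; omega, Finset.card_range]

/-- Count inversions: every pair in the first block is inverted, none in the second, and a mixed
pair `(i, j)` exactly when `i < ν'_j`. -/
theorem sign_exponent_equiv {L m : ℕ} {ν : YoungDiagram} (h : ν.colLen 0 ≤ L)
    {τ : Fin L ⊕ Fin m ≃ Fin (L + m)} (hl : ∀ i, (τ (Sum.inl i) : ℕ) = expo L ν i)
    (hr : ∀ j, (τ (Sum.inr j) : ℕ) = coexpo L m ν j) :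
    Equiv.Perm.sign (finSumFinEquiv.symm.trans τ) =
      (∏ i : Fin L, ∏ j : Fin L, if i < j then -1 else 1) * ∏ j : Fin m, (-1) ^ ν.colLen j := by
  set π : Equiv.Perm (Fin (L + m)) := finSumFinEquiv.symm.trans τ with hπ
  have hpl : ∀ i : Fin L, (π (Fin.castAdd m i) : ℕ) = expo L ν i := by
    intro i; rw [hπ, Equiv.trans_apply, finSumFinEquiv_symm_apply_castAdd, hl]
  have hpr : ∀ j : Fin m, (π (Fin.natAdd L j) : ℕ) = coexpo L m ν j := by
    intro j; rw [hπ, Equiv.trans_apply, finSumFinEquiv_symm_apply_natAdd, hr]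
  have h0 : Equiv.Perm.sign π = ∏ x, ∏ x', if x < x' then
      (if π x < π x' then (1 : ℤˣ) else -1) else 1 := by
    rw [Equiv.Perm.sign_eq_prod_prod_Ioi]
    refine Finset.prod_congr rfl fun x _ => ?_
    rw [← Finset.prod_filter]
    refine Finset.prod_congr ?_ fun _ _ => rfl
    ext; simp
  rw [h0, Fin.prod_univ_add]
  simp_rw [Fin.prod_univ_add]
  rw [Finset.prod_mul_distrib]
  have e1 : ∏ i : Fin L, ∏ j : Fin L, (if Fin.castAdd m i < Fin.castAdd m j then
      (if π (Fin.castAdd m i) < π (Fin.castAdd m j) then (1 : ℤˣ) else -1) else 1) =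
      ∏ i : Fin L, ∏ j : Fin L, if i < j then -1 else 1 := by
    refine Finset.prod_congr rfl fun i _ => Finset.prod_congr rfl fun j _ => ?_
    have h3 : π (Fin.castAdd m i) < π (Fin.castAdd m j) ↔ expo L ν i < expo L ν j := by
      rw [Fin.lt_def, hpl, hpl]
    have h4 : Fin.castAdd m i < Fin.castAdd m j ↔ i < j := Iff.rfl
    simp only [h3, h4]
    split_ifs with h1 h2
    · exact absurd h2 (not_lt.2 (expo_strictAnti L ν h1).le)
    · rfl
    · rfl
  have e2 : ∏ i : Fin L, ∏ j : Fin m, (if Fin.castAdd m i < Fin.natAdd L j then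
      (if π (Fin.castAdd m i) < π (Fin.natAdd L j) then (1 : ℤˣ) else -1) else 1) =
      ∏ j : Fin m, (-1) ^ ν.colLen j := by
    rw [Finset.prod_comm]
    refine Finset.prod_congr rfl fun j _ => ?_
    rw [← prod_ite_lt_neg_one L _ (colLen_le h j)]
    refine Finset.prod_congr rfl fun i _ => ?_
    have hi := i.2
    rw [if_pos (by rw [Fin.lt_def, Fin.val_castAdd, Fin.val_natAdd]; omega)]
    have h3 : π (Fin.castAdd m i) < π (Fin.natAdd L j) ↔ ¬ (i : ℕ) < ν.colLen j := by
      rw [Fin.lt_def, hpl, hpr, expo_lt_coexpo_iff h]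
    simp only [h3, ite_not]
  have e3 : ∏ j : Fin m, ((∏ i : Fin L, (if Fin.natAdd L j < Fin.castAdd m i then
      (if π (Fin.natAdd L j) < π (Fin.castAdd m i) then (1 : ℤˣ) else -1) else 1)) *
      ∏ j' : Fin m, (if Fin.natAdd L j < Fin.natAdd L j' then
      (if π (Fin.natAdd L j) < π (Fin.natAdd L j') then (1 : ℤˣ) else -1) else 1)) = 1 := by
    refine Finset.prod_eq_one fun j _ => ?_
    rw [Finset.prod_eq_one, Finset.prod_eq_one, one_mul]
    · intro j' _
      split_ifs with h1 h2
      · rfl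
      · rw [Fin.lt_def, hpr, hpr] at h2
        have h3 : j < j' := by
          rw [Fin.lt_def, Fin.val_natAdd, Fin.val_natAdd] at h1
          rw [Fin.lt_def]
          omega
        exact absurd (coexpo_strictMono h h3) h2
      · rfl
    · intro i _
      have hi := i.2
      rw [if_neg]
      rw [Fin.lt_def, Fin.val_castAdd, Fin.val_natAdd]
      omega
  rw [e1, e2, e3, mul_one]

/-- The reversal of `∏ (1 + y_j X)` in degree `m` is `∏ (X + y_j)`. -/
theorem eval_neg_reflect_egen {R : Type*} [CommRing R] {m : ℕ} (y : Fin m → R) (i : Fin m) :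
    ((egen y).reflect m).eval (-y i) = 0 := by
  have key : ∀ (m : ℕ) (y : Fin m → R), (egen y).reflect m =
      ∏ j, (Polynomial.X + Polynomial.C (y j)) := by
    intro m
    induction m with
    | zero => intro y; simp [egen]
    | succ m ih =>
      intro y
      rw [egen, Fin.prod_univ_castSucc, Fin.prod_univ_castSucc, Polynomial.reflect_mul]
      · have h1 := ih (y ∘ Fin.castSucc)
        simp only [Function.comp_apply, egen] at h1
        rw [h1]
        congr 1
        simp [Polynomial.reflect_C_mul]
      · exact natDegree_egen_le (y ∘ Fin.castSucc)
      · compute_degree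
  rw [key, Polynomial.eval_prod]
  exact Finset.prod_eq_zero (Finset.mem_univ i) (by simp)

theorem sum_coeff_mul_neg_pow {R : Type*} [CommRing R] {L m : ℕ} (y : Fin m → R) (i : Fin m)
    (j : Fin L) :
    ∑ x : Fin (L + m), (-y i) ^ (x.rev : ℕ) *
      (Polynomial.X ^ (j.rev : ℕ) * egen y).coeff x = 0 := by
  have hj := j.rev.2
  have hd : (Polynomial.X ^ (j.rev : ℕ) * egen y).natDegree ≤ (j.rev : ℕ) + m :=
    Polynomial.natDegree_mul_le.trans
      (Nat.add_le_add (Polynomial.natDegree_X_pow_le _) (natDegree_egen_le y))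
  have h1 := congrArg (Polynomial.eval (-y i)) (reflect_eq_sum (N := L + m)
    (P := Polynomial.X ^ (j.rev : ℕ) * egen y) (by omega))
  rw [show L + m - 1 = (L - 1) + m by omega, Polynomial.reflect_mul _ _
    ((Polynomial.natDegree_X_pow_le _).trans (by omega)) (natDegree_egen_le y),
    Polynomial.eval_mul, eval_neg_reflect_egen, mul_zero, Polynomial.eval_finsetSum] at h1
  rw [h1]
  refine Finset.sum_congr rfl fun x _ => ?_
  rw [Polynomial.eval_mul, Polynomial.eval_pow, Polynomial.eval_C, Polynomial.eval_X, mul_comm]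

theorem det_neg_pow {R : Type*} [CommRing R] {m : ℕ} (y : Fin m → R) (e : Fin m → ℕ) :
    (Matrix.of fun i j : Fin m => (-y i) ^ e j).det =
      (∏ j, (-1) ^ e j) * (Matrix.of fun i j : Fin m => y i ^ e j).det := by
  rw [← Matrix.det_mul_row]
  congr 1
  ext i j
  simp only [Matrix.of_apply]
  rw [neg_pow]

/-- Complementary minors: the exponents of `ν` select rows of the coefficient matrix of `E`, while
the complementary exponents, those of `ν'` in reversed form, select columns of the evaluation matrix
at `-y`. The two matrices annihilate each other because the reversal of `E` vanishes at `-y_i`. -/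
theorem delta_mul_jt_egen {R : Type*} [CommRing R] {L m : ℕ} (y : Fin m → R) {ν : YoungDiagram}
    (h : ν.colLen 0 ≤ L) (h' : ν.rowLen 0 ≤ m) :
    delta y * jt (egen y : PowerSeries R) (expo L ν) =
      (Matrix.of fun i j : Fin m => y i ^ expo m ν.transpose j).det := by
  obtain ⟨τ, hτl, hτr⟩ := exists_exponent_equiv h h'
  have hb : (⊥ : YoungDiagram).colLen 0 ≤ L := by rw [colLen_bot]; exact Nat.zero_le _
  obtain ⟨τ₀, hτ₀l, hτ₀r⟩ := exists_exponent_equiv (m := m) hb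
    (by rw [rowLen_bot]; exact Nat.zero_le _)
  have hτ₀l' : ∀ i, τ₀ (Sum.inl i) = Fin.castAdd m i.rev := fun i =>
    Fin.ext (by rw [hτ₀l, expo_bot, Fin.val_castAdd])
  have hτ₀r' : ∀ j, τ₀ (Sum.inr j) = Fin.natAdd L j := fun j =>
    Fin.ext (by rw [hτ₀r, coexpo, colLen_bot, Fin.val_natAdd, Nat.sub_zero])
  -- Both factors are completed to square matrices by unit vectors, `Q` along the exponents of the
  -- empty partition and `G` along the complement of `ν + ρ_L`. Computing `det (Q * G)` directly and
  -- as a product gives the identity.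
  let Q : Matrix (Fin L ⊕ Fin m) (Fin (L + m)) R := Matrix.of (Sum.elim
    (fun i x => if x = Fin.castAdd m i.rev then 1 else 0) (fun i x => (-y i) ^ (x.rev : ℕ)))
  let G : Matrix (Fin (L + m)) (Fin L ⊕ Fin m) R := Matrix.of fun x => Sum.elim
    (fun j => (Polynomial.X ^ (j.rev : ℕ) * egen y).coeff x)
    (fun j => if x = τ (Sum.inr j) then 1 else 0)
  have hjt : ∀ (α : Fin L → ℕ), jt (egen y : PowerSeries R) α = (Matrix.of fun i j : Fin L =>
      (Polynomial.X ^ (j.rev : ℕ) * egen y).coeff (α i)).det := by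
    intro α
    rw [jt]
    congr 1
    ext i j
    simp only [Matrix.of_apply]
    rw [← Polynomial.coe_X, ← Polynomial.coe_pow, ← Polynomial.coe_mul, Polynomial.coeff_coe]
  have hQ₀ : (Q.submatrix id τ₀).det = delta (-y) := by
    have : Q.submatrix id τ₀ = Matrix.fromBlocks 1 0
        (Matrix.of fun i j => (Q.submatrix id τ₀) (Sum.inr i) (Sum.inl j))
        (Matrix.of fun i j : Fin m => (-y) i ^ (j.rev : ℕ)) := by
      ext i j
      rcases i with i | i <;> rcases j with j | j
      · simp only [Q, Matrix.submatrix_apply, id, Matrix.of_apply, Sum.elim_inl, hτ₀l',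
          Matrix.fromBlocks_apply₁₁, Matrix.one_apply, Fin.castAdd_inj, Fin.rev_inj]
        exact if_congr eq_comm rfl rfl
      · simp only [Q, Matrix.submatrix_apply, id, Matrix.of_apply, Sum.elim_inl, hτ₀r',
          Matrix.fromBlocks_apply₁₂, Matrix.zero_apply]
        refine if_neg fun hc => ?_
        have := congrArg Fin.val hc
        have hi := i.rev.2
        rw [Fin.val_natAdd, Fin.val_castAdd] at this
        omega
      · rfl
      · simp only [Q, Matrix.submatrix_apply, id, Matrix.of_apply, Sum.elim_inr, hτ₀r',
          Matrix.fromBlocks_apply₂₂, Pi.neg_apply]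
        congr 1
        have hj := j.2
        rw [Fin.val_rev, Fin.val_rev, Fin.val_natAdd]
        omega
    rw [this, Matrix.det_fromBlocks_zero₁₂, Matrix.det_one, one_mul, ← delta_eq_det]
  have hG : (G.submatrix τ id).det = jt (egen y : PowerSeries R) (expo L ν) := by
    have : G.submatrix τ id = Matrix.fromBlocks (Matrix.of fun i j : Fin L =>
        (Polynomial.X ^ (j.rev : ℕ) * egen y).coeff (expo L ν i)) 0
        (Matrix.of fun i j => (G.submatrix τ id) (Sum.inr i) (Sum.inl j)) 1 := by
      ext i j
      rcases i with i | i <;> rcases j with j | j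
      · simp [G, hτl]
      · simp [G]
      · rfl
      · simp [G, Matrix.one_apply]
    rw [this, Matrix.det_fromBlocks_zero₁₂, Matrix.det_one, mul_one, hjt]
  have hQG : (Q * G).det = (Matrix.of fun i j : Fin m => (-y i) ^ expo m ν.transpose j).det := by
    have : Q * G = Matrix.fromBlocks (Matrix.of fun i j : Fin L =>
        (Polynomial.X ^ (j.rev : ℕ) * egen y).coeff (expo L ⊥ i))
        (Matrix.of fun i j => (Q * G) (Sum.inl i) (Sum.inr j)) 0
        (Matrix.of fun i j : Fin m => (-y i) ^ expo m ν.transpose j) := by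
      ext i j
      rcases i with i | i <;> rcases j with j | j
      · simp [Q, G, Matrix.mul_apply, expo_bot]
      · rfl
      · simp only [Matrix.mul_apply, Q, G, Matrix.of_apply, Sum.elim_inl, Sum.elim_inr]
        exact sum_coeff_mul_neg_pow y i j
      · simp only [Matrix.mul_apply, Q, G, Matrix.of_apply, Sum.elim_inr, mul_ite, mul_one,
          mul_zero, Finset.sum_ite_eq', Finset.mem_univ, if_true, Matrix.fromBlocks_apply₂₂]
        congr 1
        have hj := j.2
        have hc := colLen_le h j
        rw [Fin.val_rev, hτr, expo, coexpo, YoungDiagram.rowLen_transpose, Fin.val_rev]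
        omega
    rw [this, Matrix.det_fromBlocks_zero₂₁, ← hjt, jt_expo_bot (coeff_zero_egen y), one_mul]
  have hmul : (Q * G).det = (Q.submatrix id τ₀).det * (G.submatrix τ₀ id).det := by
    rw [← Matrix.det_mul, Matrix.submatrix_mul_equiv, Matrix.submatrix_id_id]
  -- Comparison with the empty partition cancels the inversions inside the first block and leaves
  -- `(-1)^|ν|`.
  have hsign : Equiv.Perm.sign (τ.trans τ₀.symm) = ∏ j : Fin m, (-1) ^ ν.colLen j := by
    have e1 := sign_exponent_equiv h hτl hτr
    have e2 := sign_exponent_equiv hb hτ₀l hτ₀r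
    have e3 : finSumFinEquiv.symm.trans τ = (finSumFinEquiv.symm.trans τ₀) *
        (finSumFinEquiv.permCongr (τ.trans τ₀.symm) : Equiv.Perm (Fin (L + m))) := by
      ext x
      simp
    rw [e3, Equiv.Perm.sign_mul, e2, Equiv.Perm.sign_permCongr] at e1
    simp only [colLen_bot, pow_zero, Finset.prod_const_one, mul_one] at e1
    exact mul_left_cancel e1
  have hperm : (G.submatrix τ id).det =
      ((Equiv.Perm.sign (τ.trans τ₀.symm) : ℤ) : R) * (G.submatrix τ₀ id).det := by
    rw [← Matrix.det_permute]
    congr 1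
    ext i j
    simp
  rw [hQG, hQ₀, det_neg_pow, delta_eq_det] at hmul
  have hd := det_neg_pow y (fun j => (j.rev : ℕ))
  simp only [Pi.neg_apply] at hmul
  rw [hd, ← delta_eq_det] at hmul
  rw [hG, hsign] at hperm
  push_cast at hperm
  have hs : (∏ j : Fin m, (-1 : R) ^ expo m ν.transpose j) =
      (∏ j : Fin m, (-1 : R) ^ ν.colLen j) * ∏ j : Fin m, (-1 : R) ^ (j.rev : ℕ) := by
    rw [← Finset.prod_mul_distrib]
    refine Finset.prod_congr rfl fun j _ => ?_
    rw [expo, pow_add, YoungDiagram.rowLen_transpose]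
  have hsq : ∀ e : Fin m → ℕ, (∏ j : Fin m, (-1 : R) ^ e j) * (∏ j : Fin m, (-1 : R) ^ e j) = 1 := by
    intro e
    rw [← Finset.prod_mul_distrib]
    refine Finset.prod_eq_one fun j _ => ?_
    rw [← mul_pow]
    simp
  have h1 := hsq (fun j => (j.rev : ℕ))
  have h2 := hsq (fun j => ν.colLen j)
  rw [hs] at hmul
  set A := ∏ j : Fin m, (-1 : R) ^ ν.colLen j
  set B := ∏ j : Fin m, (-1 : R) ^ (j.rev : ℕ)
  set T := (Matrix.of fun i j : Fin m => y i ^ expo m ν.transpose j).det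
  set g := (G.submatrix τ₀ id).det
  rw [hperm]
  linear_combination (-A * B) * hmul + B * B * T * h2 + (T - delta y * A * g) * h1

theorem map_jt {R S : Type*} [CommRing R] [CommRing S] (φ : R →+* S) (f : PowerSeries R) {L : ℕ}
    (α : Fin L → ℕ) : φ (jt f α) = jt (PowerSeries.map φ f) α := by
  rw [jt, RingHom.map_det, jt]
  congr 1
  ext i j
  simp only [RingHom.mapMatrix_apply, Matrix.map_apply, Matrix.of_apply]
  rw [← PowerSeries.coeff_map, map_mul, map_pow, PowerSeries.map_X]

/-- Division by `Δ(y)` takes place in the polynomial ring and the result is then specialized, so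
repetitions in `y` are allowed. -/
theorem schur_transpose_eq_jt_egen {R : Type*} [CommRing R] {m : ℕ} (y : Fin m → R) (L : ℕ)
    (ν : YoungDiagram) (h : ν.colLen 0 ≤ L) (h' : ν.rowLen 0 ≤ m) :
    schur ν.transpose y = jt (egen y : PowerSeries R) (expo L ν) := by
  have h1 : schurPoly m ν.transpose = jt (egen (MvPolynomial.X : Fin m → MvPolynomial (Fin m) ℤ) :
      PowerSeries (MvPolynomial (Fin m) ℤ)) (expo L ν) := by
    refine mul_left_cancel₀ (delta_X_ne_zero ℤ m) ?_
    rw [delta_mul_schurPoly (by rwa [YoungDiagram.colLen_transpose]), delta_mul_jt_egen _ h h']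
    rfl
  have h2 := map_jt (MvPolynomial.aeval y : MvPolynomial (Fin m) ℤ →ₐ[ℤ] R).toRingHom
    (egen (MvPolynomial.X : Fin m → MvPolynomial (Fin m) ℤ) :
      PowerSeries (MvPolynomial (Fin m) ℤ)) (expo L ν)
  rw [← h1] at h2
  refine h2.trans ?_
  congr 1
  rw [coe_egen, coe_egen, map_prod]
  simp

theorem LS_eq_jt {F : Type*} [Field F] {n m : ℕ} {z : Fin n → F} (hz : Function.Injective z)
    (y : Fin m → F) {L : ℕ} {lam : YoungDiagram} (hlam : lam.colLen 0 ≤ L) :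
    LS lam z y = jt (hgen z * (egen y : PowerSeries F)) (expo L lam) :=
  LS_eq_jt_of_schur_eq_jt (natDegree_egen_le y) (schur_eq_jt_hgen hz)
    (schur_transpose_eq_jt_egen y) hlam

/-! ### Complementary subsequences -/

theorem prod_orderEmbOfFin {M : Type*} [CommMonoid M] {n l : ℕ} (S : Finset (Fin n))
    (h : S.card = l) (f : Fin n → M) : ∏ s, f (S.orderEmbOfFin h s) = ∏ i ∈ S, f i := by
  conv_rhs => rw [← Finset.map_orderEmbOfFin_univ S h, Finset.prod_map]
  rfl

theorem pfDen_eq_prod {R : Type*} [CommRing R] {n : ℕ} (z : Fin n → R) (p : Fin n) :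
    pfDen z p = ∏ q, if q = p then 1 else z p - z q := by
  rw [pfDen, ← Finset.mul_prod_erase _ _ (Finset.mem_univ p), if_pos rfl, one_mul]
  refine Finset.prod_congr rfl fun q hq => ?_
  rw [if_neg (Finset.ne_of_mem_erase hq)]

theorem pfDen_orderEmbOfFin {R : Type*} [CommRing R] {n l : ℕ} (z : Fin n → R)
    (S : Finset (Fin n)) (h : S.card = l) (j : Fin l) :
    pfDen z (S.orderEmbOfFin h j) =
      pfDen (z ∘ S.orderEmbOfFin h) j * ∏ t ∈ Sᶜ, (z (S.orderEmbOfFin h j) - z t) := by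
  rw [pfDen_eq_prod, pfDen_eq_prod, ← Finset.prod_mul_prod_compl S, ← prod_orderEmbOfFin S h]
  congr 1
  · refine Finset.prod_congr rfl fun q _ => ?_
    simp
  · refine Finset.prod_congr rfl fun q hq => if_neg ?_
    rintro rfl
    exact Finset.mem_compl.1 hq (Finset.orderEmbOfFin_mem S h j)

/-- The weight of a point of `S` is its weight within `S` up to the differences with the complement;
these are the source of `1/Δ(T;S)`. -/
theorem pfWeight_orderEmbOfFin {F : Type*} [Field F] {n m l : ℕ} (z : Fin n → F) (y : Fin m → F)
    (S : Finset (Fin n)) (h : S.card = l) (j : Fin l) :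
    pfWeight z y (S.orderEmbOfFin h j) =
      (∏ t ∈ Sᶜ, (z (S.orderEmbOfFin h j) - z t))⁻¹ * pfWeight (z ∘ S.orderEmbOfFin h) y j := by
  rw [pfWeight, pfWeight, pfDen_orderEmbOfFin, Function.comp_apply, div_eq_mul_inv, div_eq_mul_inv,
    mul_inv]
  ring

theorem prod_mul_hgen {R : Type*} [CommRing R] {n l : ℕ} (z : Fin n → R) (S : Finset (Fin n))
    (h : S.card = l) :
    (∏ s, (1 - PowerSeries.C (z (S.orderEmbOfFin h s)) * PowerSeries.X)) * hgen z =
      hgen (subseq z Sᶜ) := by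
  rw [hgen, hgen, ← Finset.prod_mul_prod_compl S, ← mul_assoc,
    prod_orderEmbOfFin S h (fun i => 1 - PowerSeries.C (z i) * PowerSeries.X),
    ← Finset.prod_mul_distrib, Finset.prod_eq_one (fun i _ => one_sub_mul_geo (z i)), one_mul]
  exact (prod_orderEmbOfFin Sᶜ rfl fun i => geo (z i)).symm

theorem delta₂_subseq {R : Type*} [CommRing R] {n l : ℕ} (X : Fin n → R) (S : Finset (Fin n))
    (h : S.card = l) :
    ∏ s, ∏ t ∈ Sᶜ, ((-X) (S.orderEmbOfFin h s) - (-X) t) =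
      delta₂ (subseq X Sᶜ) (subseq X S) := by
  rw [delta₂, Finset.prod_comm]
  subst h
  rw [← prod_orderEmbOfFin Sᶜ rfl]
  refine Finset.prod_congr rfl fun t _ => Finset.prod_congr rfl fun s _ => ?_
  simp only [subseq, Pi.neg_apply]
  ring

theorem injective_subseq {R : Type*} {n : ℕ} {X : Fin n → R} (hX : Function.Injective X)
    (S : Finset (Fin n)) : Function.Injective (subseq X S) :=
  hX.comp (S.orderEmbOfFin rfl).injective

theorem injective_neg_comp {R ι : Type*} [Ring R] {X : ι → R} (hX : Function.Injective X) :
    Function.Injective (-X) := fun _ _ h => hX (neg_injective h)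

/-- Identifies one summand of `jt_expand`. The minor with its Vandermonde factor is the fully
expanded determinant for the variables of `S`, and the remaining determinant has lost these
variables. -/
theorem expand_term {F : Type*} [Field F] {n m l r : ℕ} {X : Fin n → F}
    (hX : Function.Injective X) (Y : Fin m → F) {S : Finset (Fin n)} (h : S.card = l)
    {κ θ : YoungDiagram} (hκ : κ.colLen 0 ≤ l) (hθ : θ.colLen 0 ≤ r) {γ : Fin l → ℕ}
    (hγ : ∀ i, expo l κ i = m + γ i) :
    (Matrix.of fun i j : Fin l => pfWeight (-X) Y (S.orderEmbOfFin h j) *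
        (-X) (S.orderEmbOfFin h j) ^ γ i).det *
      ((Matrix.vandermonde ((-X) ∘ S.orderEmbOfFin h)).det *
        jt ((∏ s, (1 - PowerSeries.C ((-X) (S.orderEmbOfFin h s)) * PowerSeries.X)) *
          (hgen (-X) * (egen Y : PowerSeries F))) (expo r θ)) =
      LS κ (-subseq X S) Y * LS θ (-subseq X Sᶜ) Y / delta₂ (subseq X Sᶜ) (subseq X S) := by
  rw [LS_eq_jt (injective_neg_comp (injective_subseq hX Sᶜ)) Y hθ, ← mul_assoc (∏ s, _),
    prod_mul_hgen, ← delta₂_subseq X S h]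
  have h1 := Matrix.det_mul_row
    (fun j => (∏ t ∈ Sᶜ, ((-X) (S.orderEmbOfFin h j) - (-X) t))⁻¹)
    (fun i j : Fin l => pfWeight ((-X) ∘ S.orderEmbOfFin h) Y j *
      ((-X) ∘ S.orderEmbOfFin h) j ^ γ i)
  have h2 : (Matrix.of fun i j : Fin l => pfWeight (-X) Y (S.orderEmbOfFin h j) *
      (-X) (S.orderEmbOfFin h j) ^ γ i) = Matrix.of fun i j : Fin l =>
        (∏ t ∈ Sᶜ, ((-X) (S.orderEmbOfFin h j) - (-X) t))⁻¹ *
          (pfWeight ((-X) ∘ S.orderEmbOfFin h) Y j * ((-X) ∘ S.orderEmbOfFin h) j ^ γ i) := by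
    ext i j
    rw [Matrix.of_apply, Matrix.of_apply, pfWeight_orderEmbOfFin, mul_assoc]
    rfl
  rw [h2]
  refine (congrArg (· * _) h1).trans ?_
  subst h
  rw [LS_eq_jt (injective_neg_comp (injective_subseq hX S)) Y hκ,
    jt_hgen_mul_egen_of_full (injective_neg_comp (injective_subseq hX S)) Y hγ,
    Finset.prod_inv_distrib]
  change _ * (Matrix.of fun i j => pfWeight (-subseq X S) Y j * (-subseq X S) j ^ γ i).det *
    ((Matrix.vandermonde (-subseq X S)).det * jt (hgen (-subseq X Sᶜ) * _) _) = _
  rw [div_eq_mul_inv]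
  ring

/-! ### Reordering rows -/

theorem jt_comp_perm {R : Type*} [CommRing R] (f : PowerSeries R) {L : ℕ} (α : Fin L → ℕ)
    (σ : Equiv.Perm (Fin L)) : jt f (α ∘ σ) = ((Equiv.Perm.sign σ : ℤ) : R) * jt f α := by
  rw [jt, jt, ← Matrix.det_permute]
  rfl

/-- The entries are pairwise distinct, so the chosen sorting permutation coincides with the given
`σ`. -/
theorem overlapSign_eq_sign {a b : ℕ} {μ ν κ : YoungDiagram} {σ : Equiv.Perm (Fin (a + b))}
    (h : ∀ i, expo (a + b) κ i = overlapSeq a b μ ν (σ i)) :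
    overlapSign a b μ ν = Equiv.Perm.sign σ := by
  have h1 : StrictAnti (overlapSeq a b μ ν ∘ σ) := by
    rw [show overlapSeq a b μ ν ∘ σ = expo (a + b) κ from (funext h).symm]
    exact expo_strictAnti _ _
  have hex : ∃ σ : Equiv.Perm (Fin (a + b)), StrictAnti (overlapSeq a b μ ν ∘ σ) := ⟨σ, h1⟩
  rw [overlapSign, dif_pos hex]
  congr 1
  have h2 := hex.choose_spec.eq_of_range_eq h1 (by
    rw [hex.choose.surjective.range_comp, σ.surjective.range_comp])
  have hinj : Function.Injective (overlapSeq a b μ ν) := by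
    rw [← Function.Injective.of_comp_iff' (overlapSeq a b μ ν) σ.bijective]
    exact h1.injective
  ext1 i
  exact hinj (congrFun h2 i)

theorem rowLen_firstParts {N i : ℕ} (lam : YoungDiagram) (h : i < N) :
    (firstParts N lam).rowLen i = lam.rowLen i := by
  have key : ∀ j, j < (firstParts N lam).rowLen i ↔ j < lam.rowLen i := by
    intro j
    rw [← YoungDiagram.mem_iff_lt_rowLen, ← YoungDiagram.mem_iff_lt_rowLen,
      ← YoungDiagram.mem_cells, firstParts, Finset.mem_filter, YoungDiagram.mem_cells]
    exact and_iff_left h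
  have h1 := key (lam.rowLen i)
  have h2 := key ((firstParts N lam).rowLen i)
  omega

/-- The overlap relation reorders the rows of a Jacobi-Trudi determinant. -/
theorem jt_expo_eq_of_isOverlap {R : Type*} [CommRing R] (f : PowerSeries R) {l b q : ℕ}
    {μ ν lam θ : YoungDiagram} {σ : Equiv.Perm (Fin (l + b))}
    (hσ : ∀ i : Fin (l + b), lam.rowLen i + (i.rev : ℕ) = overlapSeq l b μ ν (σ i))
    (hθ₁ : ∀ i < b, θ.rowLen i = ν.rowLen i) (hθ₂ : ∀ i, θ.rowLen (b + i) = lam.rowLen (l + b + i)) :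
    jt f (expo (l + (b + q)) lam) = ((Equiv.Perm.sign σ : ℤ) : R) *
      jt f (Fin.append (fun i : Fin l => μ.rowLen i + (i.rev : ℕ) + q) (expo (b + q) θ)) := by
  -- The permutation acts on the first `l + b` rows and fixes the `q` tail rows; the larger total
  -- length raises all exponents of the first block by `q`.
  set e : Fin (l + b) ⊕ Fin q ≃ Fin (l + (b + q)) :=
    finSumFinEquiv.trans (finCongr (add_assoc l b q)) with he
  set α := Fin.append (fun i : Fin l => μ.rowLen i + (i.rev : ℕ) + q) (expo (b + q) θ) with hα
  have hel : ∀ x, (e (Sum.inl x) : ℕ) = x := fun x => by simp [he]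
  have her : ∀ x, (e (Sum.inr x) : ℕ) = l + b + x := fun x => by simp [he]
  have h1 : ∀ x, α (e (Sum.inl x)) = overlapSeq l b μ ν x + q := by
    intro x
    refine Fin.addCases (fun i => ?_) (fun j => ?_) x
    · rw [show e (Sum.inl (Fin.castAdd b i)) = Fin.castAdd (b + q) i from
        Fin.ext (by rw [hel]; rfl), hα, Fin.append_left, overlapSeq, Fin.append_left]
    · rw [show e (Sum.inl (Fin.natAdd l j)) = Fin.natAdd l (Fin.castAdd q j) from
        Fin.ext (by rw [hel]; rfl), hα, Fin.append_right, overlapSeq, Fin.append_right, expo,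
        Fin.val_castAdd, hθ₁ j j.2, Fin.val_rev, Fin.val_rev, Fin.val_castAdd]
      have := j.2
      omega
  have h2 : ∀ x, α (e (Sum.inr x)) = expo (l + (b + q)) lam (e (Sum.inr x)) := by
    intro x
    have hx := x.2
    rw [show e (Sum.inr x) = Fin.natAdd l (Fin.natAdd b x) from
      Fin.ext (by rw [her, Fin.val_natAdd, Fin.val_natAdd, add_assoc]), hα, Fin.append_right]
    simp only [expo, Fin.val_rev, Fin.val_natAdd, hθ₂, ← add_assoc]
    omega
  have h3 : expo (l + (b + q)) lam = α ∘ (e.permCongr (Equiv.sumCongr σ 1)) := by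
    funext i
    obtain ⟨x, rfl⟩ := e.surjective i
    rw [Function.comp_apply, Equiv.permCongr_apply, Equiv.symm_apply_apply]
    rcases x with x | x
    · rw [Equiv.sumCongr_apply, Sum.map_inl, h1, ← hσ, expo, hel, Fin.val_rev, Fin.val_rev, hel]
      have := x.2
      omega
    · rw [Equiv.sumCongr_apply, Sum.map_inr, Equiv.Perm.one_apply, h2]
  rw [h3, jt_comp_perm, Equiv.Perm.sign_permCongr, Equiv.Perm.sign_sumCongr, Equiv.Perm.sign_one,
    mul_one]

/-! ### The index of a partition -/

theorem IsIndex.rowLen_le {m n p d : ℕ} {lam : YoungDiagram} {k : ℤ} (hk : IsIndex m n lam k)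
    (hp : (p : ℤ) = n - k) (hd : (d : ℤ) = m - k) : lam.rowLen p ≤ d := by
  have h := hk.1.2
  rw [← hp, ← hd, Int.toNat_natCast, Int.toNat_natCast, YoungDiagram.mem_iff_lt_rowLen] at h
  omega

theorem IsIndex.le_rowLen {m n p d : ℕ} {lam : YoungDiagram} {k : ℤ} (hk : IsIndex m n lam k)
    (hp : (p : ℤ) = n - k) (hd : (d : ℤ) = m - k) {i : ℕ} (hi : i < p) : d ≤ lam.rowLen i := by
  rcases Nat.eq_zero_or_pos d with h0 | h0
  · omega
  -- By maximality of `k`: since `d` and `p` are positive, `k + 1` still satisfies the bound `min m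
  -- n`, so its point must lie in the diagram.
  have h : ((n - (k + 1)).toNat, (m - (k + 1)).toNat) ∈ lam := by
    by_contra hc
    have : k + 1 ≤ k := hk.2 ⟨by omega, hc⟩
    omega
  have h1 := YoungDiagram.mem_iff_lt_rowLen.1 h
  have h2 := lam.rowLen_anti i (n - (k + 1)).toNat (by omega)
  omega

/-- The last entry of `μ + ρ_l` is the last part itself, since `ρ_l` ends in `0`, and it is the
smallest part. -/
theorem le_rowLen_of_le_overlapSeq {l d : ℕ} {μ : YoungDiagram}
    (h : ∀ i : Fin l, d ≤ μ.rowLen i + (i.rev : ℕ)) {i : ℕ} (hi : i < l) : d ≤ μ.rowLen i := by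
  have h1 := h ⟨l - 1, by omega⟩
  have h2 := μ.rowLen_anti i (l - 1) (by omega)
  simp only [Fin.val_rev] at h1
  omega

end Overlap

end

/-! ### The first overlap identity -/

theorem mainTheorem2 {F : Type*} [Field F] (n m : ℕ)
    (X : Fin n → F) (hX : Function.Injective X) (Y : Fin m → F)
    (lam μ ν : YoungDiagram) (k : ℤ) (hk : IsIndex m n lam k)
    (l : ℕ) (hl : (l : ℤ) ≤ min ((n : ℤ) - k) n)
    (hov : IsOverlap l ((n : ℤ) - k - l).toNat μ ν (firstParts ((n : ℤ) - k).toNat lam)) :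
    ∃ (hα : IsPartitionSeq (parts μ + rectSeq k l))
      (hβ : IsPartitionSeq (appendSeq ((n : ℤ) - k - l).toNat (parts ν)
        (tailSeq ((n : ℤ) - k).toNat (parts lam)))),
      LS lam (-X) Y =
        ∑ S ∈ Finset.powersetCard l (Finset.univ : Finset (Fin n)),
          (((overlapSign l ((n : ℤ) - k - l).toNat μ ν : ℤˣ) : ℤ) : F) *
              LS (ofSeq _ hα) (-subseq X S) Y * LS (ofSeq _ hβ) (-subseq X Sᶜ) Y /
            delta₂ (subseq X Sᶜ) (subseq X S) := by
  have hkmin : k ≤ min (m : ℤ) n := hk.1.1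
  obtain ⟨d, hd⟩ := Int.eq_ofNat_of_zero_le (a := (m : ℤ) - k) (by omega)
  obtain ⟨b, hb⟩ := Int.eq_ofNat_of_zero_le (a := (n : ℤ) - k - l) (by omega)
  have hp : ((n : ℤ) - k).toNat = l + b := by omega
  have hp' : ((l + b : ℕ) : ℤ) = n - k := by omega
  have hb' : ((n : ℤ) - k - l).toNat = b := by omega
  rw [hp, hb'] at hov ⊢
  obtain ⟨hμl, hνb, -, σ, hσ⟩ := hov
  have hσ' : ∀ i : Fin (l + b), lam.rowLen i + (i.rev : ℕ) = overlapSeq l b μ ν (σ i) := by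
    intro i
    rw [← hσ i, rowLen_firstParts lam i.2]
  have hge : ∀ x, d ≤ overlapSeq l b μ ν x := by
    intro x
    have h1 := hσ' (σ.symm x)
    have h2 := hk.le_rowLen hp' hd.symm (σ.symm x).2
    rw [Equiv.apply_symm_apply] at h1
    omega
  have hμd : ∀ i < l, d ≤ μ.rowLen i := fun i hi => le_rowLen_of_le_overlapSeq
    (fun i => by simpa [overlapSeq] using hge (Fin.castAdd b i)) hi
  have hνd : ∀ i < b, d ≤ ν.rowLen i := fun i hi => le_rowLen_of_le_overlapSeq
    (fun i => by simpa [overlapSeq] using hge (Fin.natAdd l i)) hi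
  have hlamd : lam.rowLen (l + b) ≤ d := hk.rowLen_le hp' hd.symm
  have hμ0 := colLen_le_iff.1 hμl
  have hlam0 := colLen_le_iff.1 (le_refl (lam.colLen 0))
  have hα : IsPartitionSeq (parts μ + rectSeq k l) := by
    refine ⟨fun i j hij => ?_, l, fun i hi => ?_⟩
    · have h1 := μ.rowLen_anti i j hij
      simp only [Pi.add_apply, parts, rectSeq]
      split_ifs with h2 h3 h3
      · omega
      · omega
      -- At the end of the block, `μ_i + k ≥ d + k = m ≥ 0`; this covers negative `k`.
      · have := hμ0 j (by omega)
        have := hμd i h3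
        omega
      · omega
    · simp [parts, rectSeq, hμ0 i hi, not_lt.2 hi]
  have hβ : IsPartitionSeq (appendSeq b (parts ν) (tailSeq (l + b) (parts lam))) := by
    refine ⟨fun i j hij => ?_, b + lam.colLen 0, fun i hi => ?_⟩
    · simp only [appendSeq, tailSeq, parts]
      split_ifs with h2 h3 h3
      · exact_mod_cast ν.rowLen_anti i j hij
      · omega
      -- At the junction, `d = m - k` separates the parts of `ν` from the tail of `λ`.
      · have h4 := lam.rowLen_anti (l + b) (l + b + (j - b)) (by omega)
        have h5 := hνd i h3
        omega
      · exact_mod_cast lam.rowLen_anti _ _ (by omega)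
    · simp only [appendSeq, tailSeq, parts]
      rw [if_neg (by omega), hlam0 _ (by omega), Nat.cast_zero]
  refine ⟨hα, hβ, ?_⟩
  set κ := ofSeq _ hα with hκ
  set θ := ofSeq _ hβ with hθ
  -- The determinant is taken with `l + b + q` rows, enough for all parts of `λ`; surplus rows are
  -- harmless.
  set q := lam.colLen 0 with hq
  have hκrow : ∀ i, (κ.rowLen i : ℤ) = μ.rowLen i + if i < l then k else 0 := rowLen_ofSeq _ hα
  have hθrow : ∀ i, (θ.rowLen i : ℤ) =
      if i < b then (ν.rowLen i : ℤ) else lam.rowLen (l + b + (i - b)) := rowLen_ofSeq _ hβ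
  have hκl : κ.colLen 0 ≤ l := colLen_le_iff.2 fun i hi => by
    have := hκrow i
    rw [hμ0 i hi, if_neg (by omega)] at this
    omega
  have hθ₁ : ∀ i < b, θ.rowLen i = ν.rowLen i := fun i hi => by
    have := hθrow i
    rw [if_pos hi] at this
    omega
  have hθ₂ : ∀ i, θ.rowLen (b + i) = lam.rowLen (l + b + i) := fun i => by
    have := hθrow (b + i)
    rw [if_neg (by omega), Nat.add_sub_cancel_left] at this
    omega
  have hθq : θ.colLen 0 ≤ b + q := colLen_le_iff.2 fun i hi => by
    rw [← Nat.add_sub_cancel' (show b ≤ i by omega), hθ₂, hlam0 _ (by omega)]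
  have hsign : overlapSign l b μ ν = Equiv.Perm.sign σ :=
    overlapSign_eq_sign (κ := firstParts (l + b) lam) hσ
  rw [LS_eq_jt (injective_neg_comp hX) Y (show lam.colLen 0 ≤ l + (b + q) by omega),
    jt_expo_eq_of_isOverlap _ hσ' hθ₁ hθ₂, jt_expand (injective_neg_comp hX) Y
      -- The subtraction is not truncated because `μ_i ≥ d`. With `l + b = n - k` and `d = m - k`,
      -- this exponent satisfies `m + γ i = μ_i + k + (l - 1 - i)` (indices from `0`), the entry of
      -- `κ + ρ_l` needed by `expand_term`.
      (γ := fun i => μ.rowLen i - d + (i.rev : ℕ)) _ (fun i => by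
        have := hμd i i.2
        omega), Finset.mul_sum, ← Finset.sum_attach (Finset.powersetCard l _), hsign]
  refine Finset.sum_congr rfl fun S _ => ?_
  rw [expand_term hX Y _ hκl hθq (fun i => by
    have h1 := hκrow i
    have h2 := hμd i i.2
    rw [if_pos i.2] at h1
    simp only [expo]
    omega)]
  ring
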